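/- Let $K$ be a number field, let $d\ge 2$ and $n\ge 0$ be integers, let $s_1,\dots,s_{d-1},t$ be independent transcendentals over $K$, put $K_{s,t}=K(s_1,\dots,s_{d-1},t)$, and let $$f(x)=x^d+s_1x^{d-1}+\dots+s_{d-1}x+t\in K_{s,t}[x]$$ be the generic monic polynomial of degree $d$ over $K$. Write $f'$ for the derivative of $f$ and $f^k$ for the $k$-th iterate of $f$ ($f^0(x)=x$). For a group $H$ let $S_m[H]=H^m\rtimes S_m$ be the wreath product in which $S_m$ permutes the $m$ coordinates, and let $[S_d]^0=1$, $[S_d]^{k+1}=S_d[[S_d]^k]$ be the iterated wreath products of $S_d$. Fix an algebraic closure $\overline{K_{s,t}}$, and let $K_{s,t}\big((f'\circ f^n)^{-1}(0)\big)$ be the field generated over $K_{s,t}$ by the roots of $f'\circ f^n$ in it. Then $$\mathrm{Gal}\Big(K_{s,t}\big((f'\circ f^n)^{-1}(0)\big)/K_{s,t}\Big)\cong S_{d-1}\big[[S_d]^n\big].$$ Moreover, let $T_{n+1}$ be the rooted tree whose vertices, apart from the root, are the roots in $\overline{K_{s,t}}$ of $f'\circ f^k$ for $0\le k\le n$ (those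 for a given $k$ forming the $(k+1)$-st level), where the root is joined to every root of $f'$ and a vertex $v$ of level $k+2$ is joined to the vertex $f(v)$ of level $k+1$. Then the arboreal representation $\mathrm{Gal}(\overline{K_{s,t}}/K_{s,t})\to\mathrm{Aut}(T_{n+1})$, given by the Galois action on the vertices, is surjective, and it induces an isomorphism $\mathrm{Gal}\big(K_{s,t}((f'\circ f^n)^{-1}(0))/K_{s,t}\big)\cong\mathrm{Aut}(T_{n+1})$. -/

import Mathlib

open Polynomial

noncomputable section

/-- The permutational wreath product `S_m[H] = H^m ⋊ S_m`, where `S_m = Perm (Fin m)` acts on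
`H^m = (Fin m → H)` by permuting the coordinates: `(σ • h) i = h (σ⁻¹ i)`. -/
abbrev SymWreath (m : ℕ) (H : Type) [Group H] : Type :=
  (Fin m → H) ⋊[mulAutArrow (G := Equiv.Perm (Fin m)) (A := Fin m) (M := H)] Equiv.Perm (Fin m)

/-- The `n`-th iterated wreath product `[S_d]^n`, bundled with its group structure:
`[S_d]^0` is trivial and `[S_d]^(n+1) = S_d[[S_d]^n]`. -/
def iterSymWreathGrp (d : ℕ) : ℕ → GrpCat.{0}
  | 0 => GrpCat.of PUnit
  | n + 1 => GrpCat.of (SymWreath d (iterSymWreathGrp d n))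

/-- The group `[S_d]^n`. -/
abbrev IterSymWreath (d n : ℕ) : Type := iterSymWreathGrp d n

/-- The function field `K_{s,t}`: rational functions over `K` in `d` independent transcendentals
`a_0, …, a_{d-1}`, where `t = a_0` and `s_i = a_{d-i}` for `1 ≤ i ≤ d - 1`. -/
abbrev GenericField (K : Type*) [Field K] (d : ℕ) : Type _ :=
  FractionRing (MvPolynomial (Fin d) K)

/-- The generic monic polynomial `x^d + a_{d-1} x^{d-1} + ⋯ + a_1 x + a_0` over `K_{s,t}`. -/
def genericMonic (K : Type*) [Field K] (d : ℕ) : (GenericField K d)[X] :=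
  X ^ d + ∑ i : Fin d,
    C (algebraMap (MvPolynomial (Fin d) K) (GenericField K d) (MvPolynomial.X i)) * X ^ (i : ℕ)

section Tree

variable {F : Type*} [Field F]

/-- The polynomial `f' ∘ f^n`, where `f^n` is the `n`-fold composition of `f` (and `f^0 = X`). -/
def derivCompIter (f : F[X]) (n : ℕ) : F[X] :=
  (derivative f).comp (f.comp^[n] X)

/-- `(f' ∘ f^n)⁻¹(0)`, the set of roots of `f' ∘ f^n` in an algebraic closure of `F`. -/
def critPreimages (f : F[X]) (n : ℕ) : Set (AlgebraicClosure F) :=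
  {α | aeval α (derivCompIter f n) = 0}

/-- The field `F((f' ∘ f^n)⁻¹(0))`. -/
def critField (f : F[X]) (n : ℕ) : IntermediateField F (AlgebraicClosure F) :=
  IntermediateField.adjoin F (critPreimages f n)

/-- The automorphism group of the rooted tree of backward orbits of the critical points of `f`,
truncated after the roots of `f' ∘ f^n`. Apart from the root, its vertices come in levels
`k = 0, …, n`; those of level `k` are the elements of `(f' ∘ f^k)⁻¹(0)`. The root is joined to
every vertex of level `0`, and a vertex `v` of level `k + 1` is joined to the vertex `w` of level
`k` with `f v = w`. An automorphism of the rooted tree is thus a family of permutations of the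
levels that preserves and reflects these edges. -/
def treeAut (f : F[X]) (n : ℕ) :
    Subgroup ((k : Fin (n + 1)) → Equiv.Perm (critPreimages f (k : ℕ))) where
  carrier := {σ | ∀ (k : Fin n) (v : critPreimages f (k.succ : ℕ))
    (w : critPreimages f (k.castSucc : ℕ)),
      aeval (σ k.succ v : AlgebraicClosure F) f = (σ k.castSucc w : AlgebraicClosure F) ↔
        aeval (v : AlgebraicClosure F) f = (w : AlgebraicClosure F)}
  mul_mem' := by
    intro σ τ hσ hτ k v w
    exact (hσ k (τ k.succ v) (τ k.castSucc w)).trans (hτ k v w)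
  one_mem' := by
    intro k v w
    exact Iff.rfl
  inv_mem' := by
    intro σ hσ k v w
    have h := hσ k ((σ k.succ)⁻¹ v) ((σ k.castSucc)⁻¹ w)
    have hv : σ k.succ ((σ k.succ)⁻¹ v) = v := (σ k.succ).apply_symm_apply v
    have hw : σ k.castSucc ((σ k.castSucc)⁻¹ w) = w := (σ k.castSucc).apply_symm_apply w
    rw [hv, hw] at h
    exact h.symm

theorem apply_mem_critPreimages (f : F[X]) (n : ℕ)
    (σ : AlgebraicClosure F ≃ₐ[F] AlgebraicClosure F) {α : AlgebraicClosure F}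
    (hα : α ∈ critPreimages f n) : σ α ∈ critPreimages f n := by
  have h : aeval α (derivCompIter f n) = 0 := hα
  change aeval (σ α) (derivCompIter f n) = 0
  rw [aeval_algHom_apply, h, map_zero]

/-- The arboreal Galois representation: the action of the absolute Galois group of `F` on the
truncated tree of backward orbits of the critical points of `f`. -/
def arborealRep (f : F[X]) (n : ℕ) :
    (AlgebraicClosure F ≃ₐ[F] AlgebraicClosure F) →* treeAut f n where
  toFun σ :=
    ⟨fun k =>
      { toFun := fun v => ⟨σ v, apply_mem_critPreimages f k σ v.2⟩
        invFun := fun v => ⟨σ.symm v, apply_mem_critPreimages f k σ.symm v.2⟩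
        left_inv := fun v => Subtype.ext (σ.symm_apply_apply v)
        right_inv := fun v => Subtype.ext (σ.apply_symm_apply v) },
      by
        intro k v w
        change aeval (σ (v : AlgebraicClosure F)) f = σ (w : AlgebraicClosure F) ↔ _
        rw [aeval_algHom_apply]
        exact σ.injective.eq_iff⟩
  map_one' := rfl
  map_mul' _ _ := rfl

end Tree

end

/-!
The polynomial `f' ∘ f^n` is irreducible by Eisenstein's criterion at the ideal of the coefficients
of `f`, so the Galois group is transitive on every level of the tree. Further Galois elements come
from specializing the coefficients of `f`: an automorphism over the field of coefficients of the
specialized polynomial lifts to a Galois automorphism of the generic tree with the same effect on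
the specialized vertices.

* Specializing `f` to a polynomial whose critical points are algebraically independent shows that
  all permutations of level `0` occur.
* Specializing `f` to `x ((x - a)^(d-1) - a^d) + t`, over the power series in `a` and with `t` such
  that `0` is a vertex of level `n + 1`, gives automorphisms that fix this vertex and permute its
  siblings transitively, as `x^(d-1) - a` is irreducible.
* Let the critical point `0` of `p` be periodic of exact period `n + 1`, and let no other critical
  point be eventually mapped to a critical point. Then `0` is the only multiple root of
  `p' ∘ p^(n+1)`, and it splits into two conjugate roots over the power series in `u` when `p` is
  deformed to `p + u`, so the Galois group contains a transposition of two vertices of level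
  `n + 1`. The polynomial `p` is found near `x^2 + t`, where `t` is a simple root of Gleason's
  polynomial.

A transposition of vertices must swap siblings. By transitivity all transpositions of siblings
occur, and they generate the permutations of level `n + 1` that fix level `n`. This gives
surjectivity by induction on `n`.
-/

noncomputable section

section CritIter

variable {A B : Type*} [CommRing A] [CommRing B]

/-- The polynomial `f' ∘ f^n` over a commutative ring. It extends `derivCompIter` beyond fields,
so that one can reduce it, or solve it in rings of integers and of power series. -/
def critIter (f : A[X]) (n : ℕ) : A[X] :=
  (derivative f).comp (f.comp^[n] X)

theorem map_iterate_comp_X (φ : A →+* B) (f : A[X]) (n : ℕ) :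
    (f.comp^[n] X).map φ = (f.map φ).comp^[n] X := by
  induction n with
  | zero => exact map_X φ
  | succ n ih =>
    rw [Function.iterate_succ_apply', Function.iterate_succ_apply', ← ih, Polynomial.map_comp]

theorem map_critIter (φ : A →+* B) (f : A[X]) (n : ℕ) :
    (critIter f n).map φ = critIter (f.map φ) n := by
  rw [critIter, critIter, Polynomial.map_comp, map_iterate_comp_X, derivative_map]

theorem eval_critIter (f : A[X]) (n : ℕ) (x : A) :
    (critIter f n).eval x = (derivative f).eval ((fun y => f.eval y)^[n] x) := by
  rw [critIter, eval_comp, iterate_comp_eval, eval_X]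

theorem critIter_succ (f : A[X]) (n : ℕ) : critIter f (n + 1) = (critIter f n).comp f := by
  have hiter : f.comp^[n + 1] X = (f.comp^[n] X).comp f := by
    induction n with
    | zero => rw [Function.iterate_one, comp_X, Function.iterate_zero_apply, X_comp]
    | succ n ih =>
      rw [Function.iterate_succ_apply', ih, ← comp_assoc, ← Function.iterate_succ_apply' f.comp, ih]
  rw [critIter, critIter, comp_assoc, hiter]

theorem eval_critIter_succ (f : A[X]) (n : ℕ) (x : A) :
    (critIter f (n + 1)).eval x = (critIter f n).eval (f.eval x) := by
  rw [critIter_succ, eval_comp]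

theorem derivative_iterate_comp_X (f : A[X]) (n : ℕ) :
    derivative (f.comp^[n] X) = ∏ k ∈ Finset.range n, critIter f k := by
  induction n with
  | zero => exact derivative_X
  | succ n ih =>
    rw [Function.iterate_succ_apply', derivative_comp, ih, Finset.prod_range_succ, critIter]

theorem eval_derivative_critIter (f : A[X]) (n : ℕ) (x : A) :
    (derivative (critIter f n)).eval x = (∏ k ∈ Finset.range n, (critIter f k).eval x) *
      (derivative (derivative f)).eval ((fun y => f.eval y)^[n] x) := by
  rw [critIter, derivative_comp, derivative_iterate_comp_X, eval_mul, eval_prod, eval_comp,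
    iterate_comp_eval, eval_X]

variable [IsDomain A]

theorem natDegree_iterate_comp_X (f : A[X]) (n : ℕ) :
    (f.comp^[n] X).natDegree = f.natDegree ^ n := by
  rw [natDegree_iterate_comp, natDegree_X, mul_one]

theorem monic_iterate_comp_X {f : A[X]} (hf : f.Monic) (hd : f.natDegree ≠ 0) (n : ℕ) :
    (f.comp^[n] X).Monic := by
  induction n with
  | zero => exact monic_X
  | succ n ih =>
    rw [Function.iterate_succ_apply']
    exact hf.comp ih (by rw [natDegree_iterate_comp_X]; exact pow_ne_zero _ hd)

variable [CharZero A]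

theorem natDegree_critIter (f : A[X]) (n : ℕ) :
    (critIter f n).natDegree = (f.natDegree - 1) * f.natDegree ^ n := by
  rw [critIter, natDegree_comp, natDegree_derivative, natDegree_iterate_comp_X]

theorem leadingCoeff_critIter {f : A[X]} (hf : f.Monic) (hd : f.natDegree ≠ 0) (n : ℕ) :
    (critIter f n).leadingCoeff = f.natDegree := by
  have hd' : f.natDegree - 1 + 1 = f.natDegree := Nat.sub_add_cancel (Nat.pos_of_ne_zero hd)
  rw [critIter, leadingCoeff_comp (by rw [natDegree_iterate_comp_X]; exact pow_ne_zero _ hd),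
    (monic_iterate_comp_X hf hd n).leadingCoeff, one_pow, mul_one, leadingCoeff,
    natDegree_derivative, coeff_derivative, hd', hf.coeff_natDegree, one_mul]
  exact_mod_cast congrArg (Nat.cast (R := A)) hd'

theorem critIter_ne_zero {f : A[X]} (hf : f.Monic) (hd : f.natDegree ≠ 0) (n : ℕ) :
    critIter f n ≠ 0 := by
  rw [← leadingCoeff_ne_zero, leadingCoeff_critIter hf hd]
  exact Nat.cast_ne_zero.2 hd

end CritIter

section Hensel

theorem exists_eval_add_mul_eq {R : Type*} [CommRing R] (f : R[X]) (a : R) :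
    ∃ q : R[X], ∀ y, f.eval (a + f.eval a * y) =
      f.eval a * (1 + (derivative f).eval a * y + f.eval a * y ^ 2 * q.eval (f.eval a * y)) := by
  refine ⟨(taylor a f).divX.divX, fun y => ?_⟩
  have htaylor : taylor a f =
      ((taylor a f).divX.divX * X + C ((derivative f).eval a)) * X + C (f.eval a) := by
    conv_lhs => rw [← divX_mul_X_add (taylor a f), ← divX_mul_X_add (taylor a f).divX]
    rw [coeff_divX, zero_add, taylor_coeff_one, taylor_coeff_zero]
  rw [add_comm a, ← taylor_eval, congrArg (eval _) htaylor]
  simp only [eval_add, eval_mul, eval_X, eval_C]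
  ring

theorem exists_isUnit_root_of_henselian {R : Type*} [CommRing R] {I : Ideal R} [HenselianRing R I]
    {u c : R} (hu : IsUnit u) (hc : c ∈ I) {r : R[X]} {m : ℕ} (hr : r.natDegree ≤ m) :
    ∃ z, IsUnit z ∧ z ^ (m + 2) + u * z ^ (m + 1) + c * r.eval z = 0 := by
  set H : R[X] := X ^ (m + 2) + (C u * X ^ (m + 1) + C c * r) with hH
  have hmonic : H.Monic := by
    refine monic_X_pow_add (lt_of_le_of_lt (degree_add_le _ _) (max_lt ?_ ?_))
    · exact (degree_C_mul_X_pow_le _ _).trans_lt (by exact_mod_cast Nat.lt_succ_self _)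
    · refine degree_le_natDegree.trans_lt ?_
      exact_mod_cast ((natDegree_C_mul_le _ _).trans hr).trans_lt (by omega)
  have hroot : H.eval (-u) ∈ I := by
    have : H.eval (-u) = c * r.eval (-u) := by
      simp only [hH, eval_add, eval_mul, eval_pow, eval_X, eval_C]
      ring
    exact this ▸ I.mul_mem_right _ hc
  have hderiv : IsUnit (Ideal.Quotient.mk I ((derivative H).eval (-u))) := by
    have : (derivative H).eval (-u) = (-u) ^ (m + 1) + c * (derivative r).eval (-u) := by
      simp only [hH, derivative_add, derivative_mul, derivative_X_pow, derivative_C, eval_add,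
        eval_mul, eval_pow, eval_X, eval_C, eval_zero, Nat.add_sub_cancel, Nat.cast_add,
        Nat.cast_one, show m + 2 - 1 = m + 1 from rfl]
      ring
    rw [this, map_add, Ideal.Quotient.eq_zero_iff_mem.2 (I.mul_mem_right _ hc), add_zero]
    exact (hu.neg.pow _).map _
  obtain ⟨z, hz, hzu⟩ := HenselianRing.is_henselian H hmonic (-u) hroot hderiv
  refine ⟨z, ?_, ?_⟩
  · have := isLocalHom_of_le_jacobson_bot I HenselianRing.jac
    refine IsUnit.of_map (Ideal.Quotient.mk I) _ ?_
    rw [Ideal.Quotient.eq.2 hzu]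
    exact hu.neg.map _
  · rw [IsRoot, hH] at hz
    simpa only [eval_add, eval_mul, eval_pow, eval_X, eval_C, ← add_assoc] using hz

/-- Mathlib's `HenselianRing` only asks for roots of monic polynomials. The Newton correction of
`f` at `a₀`, divided by `f a₀`, is the inverse of a root of a monic polynomial. -/
theorem exists_isRoot_of_isUnit_derivative {R : Type*} [CommRing R] {I : Ideal R}
    [HenselianRing R I] (f : R[X]) {a₀ : R} (h : f.eval a₀ ∈ I)
    (h' : IsUnit ((derivative f).eval a₀)) : ∃ a, f.IsRoot a ∧ a - a₀ ∈ I := by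
  obtain ⟨q, hq⟩ := exists_eval_add_mul_eq f a₀
  set c := f.eval a₀
  set u := (derivative f).eval a₀
  set r : R[X] := q.comp (C c * X)
  obtain ⟨z, hzunit, hz⟩ := exists_isUnit_root_of_henselian h' h (reverse_natDegree_le r)
  have : Invertible z := hzunit.invertible
  have hrev : r.reverse.eval z = q.eval (c * ⅟z) * z ^ r.natDegree := by
    have := eval₂_reverse_mul_pow (RingHom.id R) (⅟z) r
    rw [invOf_invOf, eval₂_id, eval₂_id, eval_comp, eval_mul, eval_C, eval_X] at this
    rw [← this, mul_assoc, ← mul_pow, invOf_mul_self, one_pow, mul_one]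
  have hcorrection : (1 + u * ⅟z + c * ⅟z ^ 2 * q.eval (c * ⅟z)) * z ^ (r.natDegree + 2) = 0 := by
    rw [hrev] at hz
    linear_combination hz + (u * z ^ (r.natDegree + 1) + c * q.eval (c * ⅟z) *
      z ^ r.natDegree * (1 + ⅟z * z)) * invOf_mul_self z
  refine ⟨a₀ + c * ⅟z, ?_, by rw [add_sub_cancel_left]; exact I.mul_mem_right _ h⟩
  rw [IsRoot, hq, (hzunit.pow _).mul_left_eq_zero.1 hcorrection, mul_zero]

theorem exists_powerSeries_root {k : Type*} [Field k] (f : (PowerSeries k)[X]) {a₀ : k}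
    (h : (f.map (PowerSeries.constantCoeff (R := k))).eval a₀ = 0)
    (h' : (derivative (f.map (PowerSeries.constantCoeff (R := k)))).eval a₀ ≠ 0) :
    ∃ a : PowerSeries k, f.eval a = 0 ∧ PowerSeries.constantCoeff a = a₀ := by
  have heval (g : (PowerSeries k)[X]) : PowerSeries.constantCoeff (g.eval (PowerSeries.C a₀)) =
      (g.map (PowerSeries.constantCoeff (R := k))).eval a₀ := by
    rw [← eval_map_apply, PowerSeries.constantCoeff_C]
  obtain ⟨a, ha, ha₀⟩ := exists_isRoot_of_isUnit_derivative
    (I := Ideal.span {(PowerSeries.X : PowerSeries k)}) f (a₀ := PowerSeries.C a₀)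
    (by rwa [Ideal.mem_span_singleton, PowerSeries.X_dvd_iff, heval])
    (by rwa [PowerSeries.isUnit_iff_constantCoeff, isUnit_iff_ne_zero, heval, ← derivative_map])
  rw [Ideal.mem_span_singleton, PowerSeries.X_dvd_iff, map_sub, PowerSeries.constantCoeff_C,
    sub_eq_zero] at ha₀
  exact ⟨a, ha, ha₀⟩

end Hensel

section Invariant

theorem finite_orbit_sum_monomial {B G ι : Type*} [CommRing B] [Group G] [MulSemiringAction G B]
    [Fintype ι] {x : ι → B} (hx : ∀ i, (MulAction.orbit G (x i)).Finite) (e : ι → ℕ) :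
    (MulAction.orbit G (∑ i, C (x i) * X ^ e i : B[X])).Finite := by
  refine ((Set.Finite.pi' hx).image fun y => ∑ i, C (y i) * X ^ e i).subset ?_
  rintro _ ⟨g, rfl⟩
  refine ⟨fun i => g • x i, fun i => ⟨g, rfl⟩, ?_⟩
  simp only [Finset.smul_sum, smul_mul', smul_pow', smul_C, smul_X]

theorem exists_map_prod_sub_C_orbit {A B G : Type*} [CommRing A] [CommRing B] [Algebra A B]
    [Group G] [MulSemiringAction G B] [Algebra.IsInvariant A B G] {b : B[X]}
    (hb : (MulAction.orbit G b).Finite) :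
    ∃ c : A[X][X], c.map (mapRingHom (algebraMap A B)) = ∏ y ∈ hb.toFinset, (X - C y) := by
  classical
  set P : B[X][X] := ∏ y ∈ hb.toFinset, (X - C y)
  have hsmul (g : G) : g • P = P := by
    have himage : hb.toFinset.image (g • ·) = hb.toFinset := by
      ext y
      simp only [Finset.mem_image, Set.Finite.mem_toFinset]
      exact Set.ext_iff.1 (MulAction.smul_orbit g b) y
    simp only [P, Finset.smul_prod', smul_sub, smul_X, smul_C]
    conv_rhs => rw [← himage, Finset.prod_image (MulAction.injective g).injOn]
  have hinv (i j : ℕ) : ∃ a : A, algebraMap A B a = (P.coeff i).coeff j :=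
    Algebra.IsInvariant.isInvariant (G := G) _ fun g => by rw [← coeff_smul, ← coeff_smul, hsmul]
  have hlift : P ∈ lifts (mapRingHom (algebraMap A B)) := by
    rw [lifts_iff_coeff_lifts]
    intro i
    have : P.coeff i ∈ lifts (algebraMap A B) :=
      (lifts_iff_coeff_lifts _).2 fun j => hinv i j
    exact this
  exact hlift

/-- The elements `x i` are packed into a single polynomial `b`, so that one `g` serves them all:
`ψ₂ b` is a root of the image under `ψ₁` of the polynomial `∏ (X - g • b)`. -/
theorem exists_smul_eq_of_comp_algebraMap_eq {A B E G ι : Type*} [CommRing A] [CommRing B]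
    [CommRing E] [IsDomain E] [Algebra A B] [Group G] [MulSemiringAction G B]
    [Algebra.IsInvariant A B G] [Finite ι] {ψ₁ ψ₂ : B →+* E}
    (h : ψ₁.comp (algebraMap A B) = ψ₂.comp (algebraMap A B)) {x : ι → B}
    (hx : ∀ i, (MulAction.orbit G (x i)).Finite) :
    ∃ g : G, ∀ i, ψ₁ (g • x i) = ψ₂ (x i) := by
  cases nonempty_fintype ι
  let e (i : ι) : ℕ := Fintype.equivFin ι i
  have he : Function.Injective e := Fin.val_injective.comp (Fintype.equivFin ι).injective
  let b : B[X] := ∑ i, C (x i) * X ^ e i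
  have hcoeff (i : ι) : b.coeff (e i) = x i := by
    classical
    simp only [b, finsetSum_coeff, coeff_C_mul_X_pow, he.eq_iff, Finset.sum_ite_eq,
      Finset.mem_univ, if_true]
  have hb := finite_orbit_sum_monomial hx e
  obtain ⟨c, hc⟩ := exists_map_prod_sub_C_orbit (A := A) hb
  have hagree : (∏ y ∈ hb.toFinset, (X - C y)).map (mapRingHom ψ₁) =
      (∏ y ∈ hb.toFinset, (X - C y)).map (mapRingHom ψ₂) := by
    rw [← hc, Polynomial.map_map, Polynomial.map_map, mapRingHom_comp, mapRingHom_comp, h]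
  have hzero : (∏ y ∈ hb.toFinset, (X - C y)).eval b = 0 := by
    rw [eval_prod]
    exact Finset.prod_eq_zero (hb.mem_toFinset.2 (MulAction.mem_orbit_self b))
      (by rw [eval_sub, eval_X, eval_C, sub_self])
  have hroot : ((∏ y ∈ hb.toFinset, (X - C y)).map (mapRingHom ψ₁)).eval (mapRingHom ψ₂ b) = 0 := by
    rw [hagree, eval_map_apply, hzero, map_zero]
  rw [Polynomial.map_prod, eval_prod, Finset.prod_eq_zero_iff] at hroot
  obtain ⟨y, hy, hroot⟩ := hroot
  obtain ⟨g, hg : g • b = y⟩ := hb.mem_toFinset.1 hy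
  rw [← hg, Polynomial.map_sub, map_X, map_C, eval_sub, eval_X, eval_C, sub_eq_zero] at hroot
  refine ⟨g, fun i => ?_⟩
  have := congrArg (coeff · (e i)) hroot
  simpa only [coe_mapRingHom, coeff_map, coeff_smul, hcoeff] using this.symm

variable {R F L : Type*} [CommRing R] [Field F] [Field L] [Algebra F L] [Algebra R L]

theorem finite_orbit_of_isAlgebraic [SMulCommClass Gal(L/F) R L] [Algebra.IsAlgebraic F L]
    (x : integralClosure R L) : (MulAction.orbit Gal(L/F) x).Finite := by
  refine (((minpoly F (x : L)).rootSet_finite L).preimage Subtype.val_injective.injOn).subset ?_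
  rintro _ ⟨g, rfl⟩
  have hx : IsIntegral F (x : L) := (Algebra.IsAlgebraic.isAlgebraic _).isIntegral
  refine mem_rootSet.2 ⟨minpoly.ne_zero hx, ?_⟩
  change aeval (g (x : L)) _ = 0
  rw [aeval_algHom_apply, minpoly.aeval, map_zero]

variable [Algebra R F] [IsScalarTower R F L]

instance smulCommClass_gal : SMulCommClass Gal(L/F) R L where
  smul_comm g r x := by
    rw [← IsScalarTower.algebraMap_smul F r x, ← IsScalarTower.algebraMap_smul F r (g • x)]
    exact smul_comm g (algebraMap R F r) x

theorem isInvariant_integralClosure [IsIntegrallyClosed R] [IsFractionRing R F] [IsGalois F L] :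
    Algebra.IsInvariant R (integralClosure R L) Gal(L/F) := by
  refine ⟨fun b hb => ?_⟩
  obtain ⟨c, hc⟩ := (InfiniteGalois.mem_range_algebraMap_iff_fixed (k := F) (b : L)).2 fun g =>
    congrArg Subtype.val (hb g)
  have hint : IsIntegral R c :=
    (isIntegral_algHom_iff (IsScalarTower.toAlgHom R F L) (algebraMap F L).injective).1
      (show IsIntegral R (algebraMap F L c) from hc ▸ b.2)
  obtain ⟨a, rfl⟩ := IsIntegrallyClosed.isIntegral_iff.1 hint
  exact ⟨a, Subtype.ext ((IsScalarTower.algebraMap_apply R F L a).trans hc)⟩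

theorem exists_gal_smul_eq [IsIntegrallyClosed R] [IsFractionRing R F] [IsGalois F L]
    {E ι : Type*} [CommRing E] [IsDomain E] [Finite ι] {ψ₁ ψ₂ : integralClosure R L →+* E}
    (h : ψ₁.comp (algebraMap R _) = ψ₂.comp (algebraMap R _)) (x : ι → integralClosure R L) :
    ∃ g : Gal(L/F), ∀ i, ψ₁ (g • x i) = ψ₂ (x i) :=
  have := isInvariant_integralClosure (R := R) (F := F) (L := L)
  exists_smul_eq_of_comp_algebraMap_eq h fun i => finite_orbit_of_isAlgebraic (x i)

end Invariant

section IntegralClosure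

theorem exists_extension_of_isIntegral {R S E : Type*} [CommRing R] [CommRing S] [Algebra R S]
    [Algebra.IsIntegral R S] [FaithfulSMul R S] [Field E] [IsAlgClosed E] (φ : R →+* E) :
    ∃ ψ : S →+* E, ψ.comp (algebraMap R S) = φ := by
  have : (RingHom.ker φ).IsPrime := RingHom.ker_isPrime φ
  obtain ⟨Q, -, _, hQ⟩ := Ideal.exists_ideal_over_prime_of_isIntegral (S := S) (RingHom.ker φ) ⊥
    (by
      rw [← RingHom.ker_eq_comap_bot, (RingHom.injective_iff_ker_eq_bot _).1
        (FaithfulSMul.algebraMap_injective R S)]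
      exact bot_le)
  have : Q.LiesOver (RingHom.ker φ) := ⟨hQ.symm⟩
  let _ : Algebra (R ⧸ RingHom.ker φ) E := (RingHom.kerLift φ).toAlgebra
  have : Module.IsTorsionFree (R ⧸ RingHom.ker φ) E :=
    Module.isTorsionFree_iff_algebraMap_injective.2 (RingHom.kerLift_injective φ)
  have : Module.IsTorsionFree (R ⧸ RingHom.ker φ) (S ⧸ Q) :=
    Module.isTorsionFree_iff_algebraMap_injective.2 (Ideal.quotientMap_injective' hQ.le)
  have : Algebra.IsIntegral (R ⧸ RingHom.ker φ) (S ⧸ Q) := Algebra.IsIntegral.tower_top R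
  let ψ : S ⧸ Q →ₐ[R ⧸ RingHom.ker φ] E := IsAlgClosed.lift
  exact ⟨ψ.toRingHom.comp (Ideal.Quotient.mk Q),
    RingHom.ext fun r => ψ.commutes (Ideal.Quotient.mk _ r)⟩

theorem splits_of_isUnit_leadingCoeff {R L : Type*} [CommRing R] [Field L] [IsAlgClosed L]
    [Algebra R L] {q : (integralClosure R L)[X]} (hq : IsUnit q.leadingCoeff) : q.Splits := by
  refine Splits.of_splits_map_of_injective (i := algebraMap _ L) Subtype.val_injective
    (IsAlgClosed.splits _) fun x hx => ?_
  have hint : IsIntegral (integralClosure R L) x :=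
    ⟨hq.unit⁻¹ • q, monic_of_isUnit_leadingCoeff_inv_smul hq, by
      rw [eval₂_eq_eval_map, Units.smul_def, smul_eq_C_mul, Polynomial.map_mul, eval_mul,
        (mem_roots'.1 hx).2, mul_zero]⟩
  exact ⟨⟨x, isIntegral_trans (R := R) _ hint⟩, rfl⟩

theorem exists_root_of_splits_of_map_ne_zero {A B : Type*} [CommRing A] [IsDomain A] [CommRing B]
    [IsDomain B] {φ : A →+* B} {q : A[X]} (hq : q.Splits) (hφ : q.map φ ≠ 0) {e : B}
    (he : (q.map φ).eval e = 0) : ∃ y, q.eval y = 0 ∧ φ y = e := by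
  obtain ⟨y, hy, hye⟩ := Multiset.mem_map.1
    (hq.roots_map_of_ne_zero hφ ▸ mem_roots'.2 ⟨hφ, he⟩)
  exact ⟨y, (mem_roots'.1 hy).2, hye⟩

end IntegralClosure

section Vertex

variable {F : Type*} [Field F] {f : F[X]} {n : ℕ}

theorem mem_critPreimages_iff {x : AlgebraicClosure F} :
    x ∈ critPreimages f n ↔ (critIter (f.map (algebraMap F _)) n).eval x = 0 := by
  rw [← map_critIter, eval_map_algebraMap]
  rfl

theorem mem_critPreimages_succ_iff {x : AlgebraicClosure F} :
    x ∈ critPreimages f (n + 1) ↔ aeval x f ∈ critPreimages f n := by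
  rw [mem_critPreimages_iff, mem_critPreimages_iff, eval_critIter_succ, eval_map_algebraMap]

instance : MulAction Gal(AlgebraicClosure F/F) (critPreimages f n) where
  smul g x := ⟨g x, apply_mem_critPreimages f n g x.2⟩
  one_smul _ := rfl
  mul_smul _ _ _ := rfl

/-- The vertex of level `n` below a vertex of level `n + 1` of the tree of backward orbits of the
critical points of `f`. -/
def parent (x : critPreimages f (n + 1)) : critPreimages f n :=
  ⟨aeval (x : AlgebraicClosure F) f, mem_critPreimages_succ_iff.1 x.2⟩

theorem parent_smul (g : Gal(AlgebraicClosure F/F)) (x : critPreimages f (n + 1)) :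
    parent (g • x) = g • parent x :=
  Subtype.ext (aeval_algHom_apply g.toAlgHom (x : AlgebraicClosure F) f)

end Vertex

section Generic

variable (K : Type*) [Field K] (d : ℕ)

/-- The generic monic polynomial over the polynomial ring in its coefficients. -/
def genericMonicInt : (MvPolynomial (Fin d) K)[X] :=
  X ^ d + ∑ i : Fin d, C (MvPolynomial.X i) * X ^ (i : ℕ)

/-- An algebraic closure of `K(s, t)`. -/
abbrev GenericClosure : Type _ :=
  AlgebraicClosure (GenericField K d)

/-- The integral closure of `K[s, t]` in the algebraic closure of `K(s, t)`. -/
abbrev GenericIntegers : Type _ :=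
  integralClosure (MvPolynomial (Fin d) K) (GenericClosure K d)

/-- The vertices of level `n` of the tree of backward orbits of the critical points of the generic
monic polynomial. -/
abbrev GenericVertex (n : ℕ) : Type _ :=
  critPreimages (genericMonic K d) n

/-- The generic monic polynomial over the integral closure of `K[s, t]`. -/
def genericMonicClosure : (GenericIntegers K d)[X] :=
  (genericMonicInt K d).map (algebraMap _ _)

theorem map_genericMonicInt :
    (genericMonicInt K d).map (algebraMap _ (GenericField K d)) = genericMonic K d := by
  simp only [genericMonicInt, genericMonic, Polynomial.map_add, Polynomial.map_pow, map_X,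
    Polynomial.map_sum, Polynomial.map_mul, map_C]

theorem monic_genericMonicInt : (genericMonicInt K d).Monic :=
  monic_X_pow_add (degree_sum_fin_lt _)

theorem natDegree_genericMonicInt : (genericMonicInt K d).natDegree = d := by
  refine natDegree_eq_of_degree_eq_some ?_
  rw [genericMonicInt, degree_add_eq_left_of_degree_lt, degree_X_pow]
  rw [degree_X_pow]
  exact degree_sum_fin_lt _

theorem coeff_genericMonicInt (i : Fin d) :
    (genericMonicInt K d).coeff i = MvPolynomial.X i := by
  simp only [genericMonicInt, coeff_add, coeff_X_pow, finsetSum_coeff, coeff_C_mul, mul_ite,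
    mul_one, mul_zero, i.2.ne, if_false, zero_add, Fin.val_inj, Finset.sum_ite_eq,
    Finset.mem_univ, if_true]

theorem monic_genericMonic : (genericMonic K d).Monic := by
  rw [← map_genericMonicInt]
  exact (monic_genericMonicInt K d).map _

theorem natDegree_genericMonic : (genericMonic K d).natDegree = d := by
  rw [← map_genericMonicInt, (monic_genericMonicInt K d).natDegree_map, natDegree_genericMonicInt]

theorem monic_genericMonicClosure : (genericMonicClosure K d).Monic :=
  (monic_genericMonicInt K d).map _

theorem natDegree_genericMonicClosure : (genericMonicClosure K d).natDegree = d := by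
  rw [genericMonicClosure, (monic_genericMonicInt K d).natDegree_map, natDegree_genericMonicInt]

theorem map_genericMonicClosure :
    (genericMonicClosure K d).map (algebraMap _ (GenericClosure K d)) =
      (genericMonic K d).map (algebraMap _ _) := by
  rw [← map_genericMonicInt, genericMonicClosure, Polynomial.map_map, Polynomial.map_map,
    ← IsScalarTower.algebraMap_eq, ← IsScalarTower.algebraMap_eq]

theorem map_critIter_genericMonicClosure (n : ℕ) :
    (critIter (genericMonicClosure K d) n).map (algebraMap _ (GenericClosure K d)) =
      critIter ((genericMonic K d).map (algebraMap _ _)) n := by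
  rw [map_critIter, map_genericMonicClosure]

variable [CharZero K]

instance charZero_mvPolynomial : CharZero (MvPolynomial (Fin d) K) :=
  charZero_of_injective_algebraMap (MvPolynomial.C_injective (Fin d) K)

instance charZero_genericField : CharZero (GenericField K d) :=
  charZero_of_injective_algebraMap (IsFractionRing.injective (MvPolynomial (Fin d) K) _)

instance charZero_genericClosure : CharZero (GenericClosure K d) :=
  charZero_of_injective_algebraMap (algebraMap (GenericField K d) _).injective

instance charZero_genericIntegers : CharZero (GenericIntegers K d) :=
  ⟨fun _ _ h => Nat.cast_injective (R := GenericClosure K d) (congrArg Subtype.val h)⟩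

instance faithfulSMul_genericClosure : FaithfulSMul (MvPolynomial (Fin d) K)
    (GenericClosure K d) := by
  rw [faithfulSMul_iff_algebraMap_injective, IsScalarTower.algebraMap_eq _ (GenericField K d) _]
  exact (algebraMap (GenericField K d) _).injective.comp
    (IsFractionRing.injective (MvPolynomial (Fin d) K) _)

instance faithfulSMul_genericIntegers : FaithfulSMul (MvPolynomial (Fin d) K)
    (GenericIntegers K d) := by
  refine (faithfulSMul_iff_algebraMap_injective _ _).2 (.of_comp (f := Subtype.val) ?_)
  exact FaithfulSMul.algebraMap_injective _ (GenericClosure K d)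

variable [NeZero d]

theorem splits_critIter_genericMonicClosure (n : ℕ) :
    (critIter (genericMonicClosure K d) n).Splits := by
  refine splits_of_isUnit_leadingCoeff ?_
  rw [leadingCoeff_critIter (monic_genericMonicClosure K d)
    (by rw [natDegree_genericMonicClosure]; exact NeZero.ne d), natDegree_genericMonicClosure]
  exact_mod_cast (Nat.cast_ne_zero.2 (NeZero.ne d) : (d : K) ≠ 0).isUnit.map
    (algebraMap K (GenericIntegers K d))

theorem critIter_genericMonicClosure_ne_zero (n : ℕ) : critIter (genericMonicClosure K d) n ≠ 0 :=
  critIter_ne_zero (monic_genericMonicClosure K d)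
    (by rw [natDegree_genericMonicClosure]; exact NeZero.ne d) n

instance finite_genericVertex (n : ℕ) : Finite (GenericVertex K d n) := by
  have hne : critIter (genericMonic K d) n ≠ 0 :=
    critIter_ne_zero (monic_genericMonic K d)
      (by rw [natDegree_genericMonic]; exact NeZero.ne d) n
  exact ((rootSet_finite (critIter (genericMonic K d) n) (GenericClosure K d)).subset
    fun _ hx => mem_rootSet.2 ⟨hne, hx⟩).to_subtype

end Generic

section VertexInteger

variable {K : Type*} [Field K] {d n : ℕ}

theorem coe_eval_genericIntegers (q : (GenericIntegers K d)[X]) (x : GenericIntegers K d) :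
    ((q.eval x : GenericIntegers K d) : GenericClosure K d) =
      (q.map (algebraMap _ (GenericClosure K d))).eval (x : GenericClosure K d) :=
  (eval_map_apply (algebraMap (GenericIntegers K d) (GenericClosure K d)) x).symm

theorem coe_mem_critPreimages_iff {x : GenericIntegers K d} :
    (x : GenericClosure K d) ∈ critPreimages (genericMonic K d) n ↔
      (critIter (genericMonicClosure K d) n).eval x = 0 := by
  rw [mem_critPreimages_iff, ← map_critIter_genericMonicClosure, ← coe_eval_genericIntegers]
  exact ZeroMemClass.coe_eq_zero

variable [CharZero K] [NeZero d]

theorem isIntegral_genericVertex (x : GenericVertex K d n) :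
    IsIntegral (MvPolynomial (Fin d) K) (x : GenericClosure K d) := by
  have hx := mem_critPreimages_iff.1 x.2
  rw [← map_critIter_genericMonicClosure] at hx
  obtain ⟨y, -, hy⟩ := exists_root_of_splits_of_map_ne_zero
    (splits_critIter_genericMonicClosure K d n)
    ((Polynomial.map_ne_zero_iff Subtype.val_injective).2
      (critIter_genericMonicClosure_ne_zero K d n)) hx
  exact hy ▸ y.2

/-- A vertex as an element of the integral closure of `K[s, t]`, so that it can be specialized. -/
def vertexInteger (x : GenericVertex K d n) : GenericIntegers K d :=
  ⟨x, isIntegral_genericVertex x⟩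

theorem eval_vertexInteger (x : GenericVertex K d n) :
    (critIter (genericMonicClosure K d) n).eval (vertexInteger x) = 0 :=
  coe_mem_critPreimages_iff.1 x.2

theorem exists_vertexInteger_eq {x : GenericIntegers K d}
    (hx : (critIter (genericMonicClosure K d) n).eval x = 0) :
    ∃ y : GenericVertex K d n, vertexInteger y = x :=
  ⟨⟨x, coe_mem_critPreimages_iff.2 hx⟩, rfl⟩

theorem vertexInteger_injective :
    Function.Injective (vertexInteger : GenericVertex K d n → GenericIntegers K d) :=
  fun _ _ h => Subtype.ext (congrArg (algebraMap _ (GenericClosure K d)) h)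

theorem eval_genericMonicClosure_vertexInteger (x : GenericVertex K d (n + 1)) :
    (genericMonicClosure K d).eval (vertexInteger x) = vertexInteger (parent x) := by
  refine Subtype.ext ?_
  rw [coe_eval_genericIntegers, map_genericMonicClosure, eval_map_algebraMap]
  rfl

end VertexInteger

section Specialization

variable {K E : Type*} [Field K] [Field E] [Algebra K E] {d : ℕ}

/-- A specialization of the generic monic polynomial to the polynomial `p`: a homomorphism over `K`
from the integral closure of `K[s, t]` that takes the generic polynomial to `p`. -/
structure IsSpecialization (p : E[X]) (ψ : GenericIntegers K d →+* E) : Prop where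
  map_eq : (genericMonicClosure K d).map ψ = p
  map_algebraMap : ∀ c : K, ψ (algebraMap (MvPolynomial (Fin d) K) _ (MvPolynomial.C c)) =
    algebraMap K E c

theorem map_genericMonicInt_aeval_coeff {p : E[X]} (hp : p.Monic) (hd : p.natDegree = d) :
    (genericMonicInt K d).map (MvPolynomial.aeval fun i : Fin d => p.coeff i).toRingHom = p := by
  conv_rhs => rw [hp.as_sum, hd, ← Fin.sum_univ_eq_sum_range fun i => C (p.coeff i) * X ^ i]
  simp only [genericMonicInt, Polynomial.map_add, Polynomial.map_pow, map_X, Polynomial.map_sum,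
    Polynomial.map_mul, map_C, AlgHom.toRingHom_eq_coe, RingHom.coe_coe, MvPolynomial.aeval_X]

theorem exists_isSpecialization [IsAlgClosed E] {p : E[X]} (hp : p.Monic)
    (hd : p.natDegree = d) : ∃ ψ : GenericIntegers K d →+* E, IsSpecialization p ψ := by
  obtain ⟨ψ, hψ⟩ := exists_extension_of_isIntegral (S := GenericIntegers K d)
    (MvPolynomial.aeval (R := K) fun i : Fin d => p.coeff i).toRingHom
  refine ⟨ψ, ?_, fun c => ?_⟩
  · rw [genericMonicClosure, Polynomial.map_map, hψ, map_genericMonicInt_aeval_coeff hp hd]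
  · exact (RingHom.congr_fun hψ (MvPolynomial.C c)).trans (MvPolynomial.aeval_C _ c)

theorem derivative_eval_eq_zero_of_map_eq {A B : Type*} [CommRing A] [IsDomain A] [CommRing B]
    (φ : A →+* B) {q : A[X]} {x y : A} (hx : q.eval x = 0) (hy : q.eval y = 0) (hxy : x ≠ y)
    (h : φ x = φ y) : (derivative (q.map φ)).eval (φ x) = 0 := by
  obtain ⟨r, rfl⟩ := dvd_iff_isRoot.2 (show IsRoot _ x from hx)
  have hry : r.eval y = 0 := by
    rw [eval_mul, eval_sub, eval_X, eval_C] at hy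
    exact (mul_eq_zero.1 hy).resolve_left (sub_ne_zero.2 hxy.symm)
  have hrx : (r.map φ).eval (φ x) = 0 := by rw [h, eval_map_apply, hry, map_zero]
  rw [Polynomial.map_mul, derivative_mul, eval_add, eval_mul, eval_mul, hrx, Polynomial.map_sub,
    map_X, map_C, eval_sub, eval_X, eval_C, sub_self, mul_zero, zero_mul, add_zero]

namespace IsSpecialization

variable {p : E[X]} {ψ : GenericIntegers K d →+* E}

theorem map_critIter_eq (h : IsSpecialization p ψ) (n : ℕ) :
    (critIter (genericMonicClosure K d) n).map ψ = critIter p n := by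
  rw [map_critIter, h.map_eq]

theorem apply_coeff (h : IsSpecialization p ψ) (σ : E →ₐ[K] E) (hσ : p.map σ = p)
    (r : MvPolynomial (Fin d) K) : σ (ψ (algebraMap _ _ r)) = ψ (algebraMap _ _ r) := by
  induction r using MvPolynomial.induction_on with
  | C c => rw [h.map_algebraMap, σ.commutes]
  | add q r hq hr => rw [map_add, map_add, map_add, hq, hr]
  | mul_X q i hq =>
    have hi : ψ (algebraMap (MvPolynomial (Fin d) K) _ (MvPolynomial.X i)) = p.coeff i := by
      rw [← h.map_eq, coeff_map, genericMonicClosure, coeff_map, coeff_genericMonicInt]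
    have hσi : σ (p.coeff i) = p.coeff i := by
      conv_rhs => rw [← hσ, coeff_map]
      rfl
    rw [map_mul, map_mul, map_mul, hq, hi, hσi]

variable {n : ℕ} [CharZero K] [NeZero d]

theorem eval_vertex (h : IsSpecialization p ψ) (x : GenericVertex K d n) :
    (critIter p n).eval (ψ (vertexInteger x)) = 0 := by
  rw [← h.map_critIter_eq, eval_map_apply, eval_vertexInteger, map_zero]

theorem eval_vertex_eq_parent (h : IsSpecialization p ψ) (x : GenericVertex K d (n + 1)) :
    p.eval (ψ (vertexInteger x)) = ψ (vertexInteger (parent x)) := by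
  rw [← eval_genericMonicClosure_vertexInteger, ← h.map_eq, eval_map_apply]

theorem exists_vertex_eq (h : IsSpecialization p ψ) (hp : critIter p n ≠ 0) {e : E}
    (he : (critIter p n).eval e = 0) : ∃ x : GenericVertex K d n, ψ (vertexInteger x) = e := by
  rw [← h.map_critIter_eq] at he hp
  obtain ⟨y, hy, rfl⟩ := exists_root_of_splits_of_map_ne_zero
    (splits_critIter_genericMonicClosure K d n) hp he
  obtain ⟨x, rfl⟩ := exists_vertexInteger_eq hy
  exact ⟨x, rfl⟩

theorem derivative_critIter_eq_zero (h : IsSpecialization p ψ) {x y : GenericVertex K d n}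
    (hxy : x ≠ y) (hψ : ψ (vertexInteger x) = ψ (vertexInteger y)) :
    (derivative (critIter p n)).eval (ψ (vertexInteger x)) = 0 := by
  rw [← h.map_critIter_eq]
  exact derivative_eval_eq_zero_of_map_eq ψ (eval_vertexInteger x) (eval_vertexInteger y)
    (vertexInteger_injective.ne hxy) hψ

theorem derivative_eq_zero_of_parent_eq (h : IsSpecialization p ψ)
    {x y : GenericVertex K d (n + 1)} (hparent : parent x = parent y) (hxy : x ≠ y)
    (hψ : ψ (vertexInteger x) = ψ (vertexInteger y)) :
    (derivative p).eval (ψ (vertexInteger x)) = 0 := by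
  have hroot (z : GenericVertex K d (n + 1)) (hz : parent z = parent y) :
      (genericMonicClosure K d - C (vertexInteger (parent y))).eval (vertexInteger z) = 0 := by
    rw [eval_sub, eval_C, eval_genericMonicClosure_vertexInteger, hz, sub_self]
  have := derivative_eval_eq_zero_of_map_eq ψ (hroot x hparent) (hroot y rfl)
    (vertexInteger_injective.ne hxy) hψ
  rwa [Polynomial.map_sub, map_C, derivative_sub, derivative_C, sub_zero, h.map_eq] at this

theorem exists_gal_lifting_algHom (h : IsSpecialization p ψ) (σ : E →ₐ[K] E)
    (hσ : p.map σ = p) (n : ℕ) :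
    ∃ g : Gal(GenericClosure K d/GenericField K d), ∀ x : GenericVertex K d n,
      ψ (vertexInteger (g • x)) = σ (ψ (vertexInteger x)) := by
  obtain ⟨g, hg⟩ := exists_gal_smul_eq (F := GenericField K d) (ψ₁ := ψ)
    (ψ₂ := (σ : E →+* E).comp ψ) (RingHom.ext fun r => (h.apply_coeff σ hσ r).symm)
    (vertexInteger : GenericVertex K d n → GenericIntegers K d)
  exact ⟨g, hg⟩

end IsSpecialization

end Specialization

section Irreducible

variable {A : Type*} [CommRing A] {d : ℕ}

theorem critIter_X_pow (d n : ℕ) :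
    critIter (X ^ d : A[X]) n = C (d : A) * X ^ (d ^ n * (d - 1)) := by
  have hiter : (X ^ d : A[X]).comp^[n] X = X ^ d ^ n := by
    induction n with
    | zero => rw [Function.iterate_zero_apply, pow_zero, pow_one]
    | succ n ih => rw [Function.iterate_succ_apply', ih, X_pow_comp, ← pow_mul, pow_succ]
  rw [critIter, hiter, derivative_X_pow, mul_comp, C_comp, X_pow_comp, ← pow_mul]

theorem eval_zero_critIter_X_pow_add_C_mul_X (hd : 2 ≤ d) (a : A) (n : ℕ) :
    (critIter (X ^ d + C a * X) n).eval 0 = a := by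
  have hfix : (X ^ d + C a * X).eval 0 = 0 := by
    rw [eval_add, eval_mul, eval_pow, eval_X, mul_zero, zero_pow (by omega), add_zero]
  have hiter : (fun y => (X ^ d + C a * X).eval y)^[n] 0 = 0 := Function.iterate_fixed hfix n
  rw [eval_critIter, hiter, derivative_add, derivative_X_pow, derivative_C_mul, derivative_X,
    mul_one, eval_add, eval_mul, eval_pow, eval_X, zero_pow (by omega), mul_zero, zero_add, eval_C]

variable (K : Type*) [Field K]

theorem map_constantCoeff_genericMonicInt :
    (genericMonicInt K d).map (MvPolynomial.constantCoeff (R := K)) = X ^ d := by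
  simp only [genericMonicInt, Polynomial.map_add, Polynomial.map_pow, map_X, Polynomial.map_sum,
    Polynomial.map_mul, map_C, MvPolynomial.constantCoeff_X, C_0, zero_mul,
    Finset.sum_const_zero, add_zero]

/-- The specialization of `f` to `x^d + a x` detects the linear term of the constant coefficient of
`f' ∘ f^n`. -/
theorem coeff_zero_critIter_notMem (hd : 2 ≤ d) (n : ℕ) :
    (critIter (genericMonicInt K d) n).coeff 0 ∉
      RingHom.ker (MvPolynomial.constantCoeff (R := K) (σ := Fin d)) ^ 2 := by
  let χ : MvPolynomial (Fin d) K →ₐ[K] K[X] :=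
    MvPolynomial.aeval fun i => if (i : ℕ) = 1 then X else 0
  have hχ : constantCoeff.comp χ.toRingHom =
      MvPolynomial.constantCoeff (R := K) (σ := Fin d) := by
    refine MvPolynomial.ringHom_ext (fun c => ?_) fun i => ?_
    · simp [χ]
    · simp only [χ, AlgHom.toRingHom_eq_coe, RingHom.comp_apply, RingHom.coe_coe,
        MvPolynomial.aeval_X, MvPolynomial.constantCoeff_X, constantCoeff_apply]
      split_ifs
      exacts [coeff_X_zero, coeff_zero 0]
  have hmap : (genericMonicInt K d).map χ.toRingHom = X ^ d + C X * X := by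
    rw [genericMonicInt, Polynomial.map_add, Polynomial.map_pow, map_X, Polynomial.map_sum,
      Finset.sum_eq_single_of_mem (⟨1, by omega⟩ : Fin d) (Finset.mem_univ _)]
    · simp [χ]
    · intro i _ hi
      simp [χ, Fin.ext_iff.not.1 hi]
  have hval : χ ((critIter (genericMonicInt K d) n).coeff 0) = X := by
    rw [← eval_zero_critIter_X_pow_add_C_mul_X hd X n, ← hmap, ← map_critIter,
      ← coeff_zero_eq_eval_zero, coeff_map]
    rfl
  intro hmem
  have hle : (RingHom.ker (MvPolynomial.constantCoeff (R := K) (σ := Fin d))).map χ.toRingHom ≤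
      Ideal.span {X} := by
    rw [Ideal.map_le_iff_le_comap]
    intro r hr
    rw [Ideal.mem_comap, Ideal.mem_span_singleton, X_dvd_iff]
    exact (RingHom.congr_fun hχ r).trans hr
  have hdvd : (X : K[X]) ^ 2 ∣ X := by
    rw [← Ideal.mem_span_singleton, ← Ideal.span_singleton_pow]
    refine Ideal.pow_right_mono hle 2 ?_
    rw [← Ideal.map_pow, ← hval]
    exact Ideal.mem_map_of_mem χ.toRingHom hmem
  exact one_ne_zero (coeff_X_one.symm.trans (X_pow_dvd_iff.1 hdvd 1 one_lt_two))

variable [CharZero K]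

theorem isPrimitive_critIter_genericMonicInt [NeZero d] (n : ℕ) :
    (critIter (genericMonicInt K d) n).IsPrimitive := by
  intro r hr
  have hdvd := C_dvd_iff_dvd_coeff r _ |>.1 hr (critIter (genericMonicInt K d) n).natDegree
  rw [coeff_natDegree, leadingCoeff_critIter (monic_genericMonicInt K d)
    (by rw [natDegree_genericMonicInt]; exact NeZero.ne d), natDegree_genericMonicInt] at hdvd
  refine isUnit_of_dvd_unit hdvd ?_
  rw [← map_natCast (MvPolynomial.C (σ := Fin d) (R := K))]
  exact (Nat.cast_ne_zero.2 (NeZero.ne d)).isUnit.map _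

/-- Eisenstein's criterion at the ideal generated by the coefficients of the generic polynomial. -/
theorem irreducible_critIter_genericMonic (hd : 2 ≤ d) (n : ℕ) :
    Irreducible (critIter (genericMonic K d) n) := by
  have : NeZero d := ⟨by omega⟩
  have hd0 : (genericMonicInt K d).natDegree ≠ 0 := by rw [natDegree_genericMonicInt]; omega
  have hprim := isPrimitive_critIter_genericMonicInt K (d := d) n
  have hdeg := natDegree_critIter (genericMonicInt K d) n
  rw [natDegree_genericMonicInt] at hdeg
  have hirr : Irreducible (critIter (genericMonicInt K d) n) := by
    refine irreducible_of_eisenstein_criterion (RingHom.ker_isPrime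
      (MvPolynomial.constantCoeff (R := K) (σ := Fin d))) ?_ (fun m hm => ?_) ?_
      (coeff_zero_critIter_notMem K hd n) hprim
    · rw [leadingCoeff_critIter (monic_genericMonicInt K d) hd0, natDegree_genericMonicInt,
        RingHom.mem_ker, map_natCast]
      exact Nat.cast_ne_zero.2 (NeZero.ne d)
    · rw [degree_eq_natDegree (critIter_ne_zero (monic_genericMonicInt K d) hd0 n), hdeg,
        Nat.cast_lt, mul_comm] at hm
      rw [RingHom.mem_ker, ← coeff_map, map_critIter, map_constantCoeff_genericMonicInt,
        critIter_X_pow, coeff_C_mul_X_pow, if_neg hm.ne]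
    · rw [← natDegree_pos_iff_degree_pos, hdeg]
      exact Nat.mul_pos (by omega) (pow_pos (by omega) n)
  have := (hprim.irreducible_iff_irreducible_map_fraction_map (K := GenericField K d)).1 hirr
  rwa [map_critIter, map_genericMonicInt] at this

theorem isPretransitive_genericVertex (hd : 2 ≤ d) (n : ℕ) :
    MulAction.IsPretransitive Gal(GenericClosure K d/GenericField K d) (GenericVertex K d n) := by
  refine ⟨fun x y => ?_⟩
  have hminpoly := minpoly.eq_of_irreducible (irreducible_critIter_genericMonic K hd n)
    (show aeval (y : GenericClosure K d) _ = 0 from y.2)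
  obtain ⟨σ, hσ⟩ := minpoly.exists_algEquiv_of_root (K := GenericField K d)
    (x := (x : GenericClosure K d)) (y := (y : GenericClosure K d))
    (Algebra.IsAlgebraic.isAlgebraic _) (by
      rw [← hminpoly, map_mul, show aeval (x : GenericClosure K d)
        (critIter (genericMonic K d) n) = 0 from x.2, zero_mul])
  exact ⟨σ, Subtype.ext hσ⟩

theorem card_genericVertex (hd : 2 ≤ d) (n : ℕ) :
    Nat.card (GenericVertex K d n) = (d - 1) * d ^ n := by
  have hirr := irreducible_critIter_genericMonic K hd n
  have hset : critPreimages (genericMonic K d) n =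
      (critIter (genericMonic K d) n).rootSet (GenericClosure K d) := by
    ext x
    exact (mem_rootSet.trans (and_iff_right hirr.ne_zero)).symm
  rw [GenericVertex, hset, Nat.card_eq_fintype_card,
    card_rootSet_eq_natDegree hirr.separable (IsAlgClosed.splits _), natDegree_critIter,
    natDegree_genericMonic]

variable {K}

theorem separable_genericMonic_sub_C (hd : 2 ≤ d) {n : ℕ} (y : GenericVertex K d n) :
    ((genericMonic K d).map (algebraMap _ (GenericClosure K d)) -
      C (y : GenericClosure K d)).Separable := by
  have hsep := (irreducible_critIter_genericMonic K hd (n + 1)).separable.map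
    (f := algebraMap _ (GenericClosure K d))
  obtain ⟨r, hr⟩ := dvd_iff_isRoot.2 (show IsRoot _ _ from mem_critPreimages_iff.1 y.2)
  refine hsep.of_dvd ⟨r.comp ((genericMonic K d).map (algebraMap _ _)), ?_⟩
  rw [map_critIter, critIter_succ, hr, mul_comp, sub_comp, X_comp, C_comp]

theorem card_children (hd : 2 ≤ d) {n : ℕ} (y : GenericVertex K d n) :
    Nat.card {x : GenericVertex K d (n + 1) // parent x = y} = d := by
  let q : (GenericClosure K d)[X] :=
    (genericMonic K d).map (algebraMap _ _) - C (y : GenericClosure K d)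
  have hsep : q.Separable := separable_genericMonic_sub_C hd y
  have hdegree : q.natDegree = d := by
    rw [natDegree_sub_C, natDegree_map, natDegree_genericMonic]
  have hmem {x : GenericClosure K d} : x ∈ q.rootSet (GenericClosure K d) ↔
      aeval x (genericMonic K d) = y := by
    rw [mem_rootSet, and_iff_right hsep.ne_zero, coe_aeval_eq_eval, eval_sub, eval_C,
      eval_map_algebraMap, sub_eq_zero]
  let e : {x : GenericVertex K d (n + 1) // parent x = y} ≃ q.rootSet (GenericClosure K d) :=
    { toFun := fun x => ⟨x.1, hmem.2 (congrArg Subtype.val x.2)⟩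
      invFun := fun x => ⟨⟨x, mem_critPreimages_succ_iff.2 (by rw [hmem.1 x.2]; exact y.2)⟩,
        Subtype.ext (hmem.1 x.2)⟩
      left_inv := fun _ => rfl
      right_inv := fun _ => rfl }
  rw [Nat.card_congr e, Nat.card_eq_fintype_card,
    card_rootSet_eq_natDegree hsep (IsAlgClosed.splits _), hdegree]

end Irreducible

section CriticalPoints

section Antiderivative

variable {E : Type*} [Field E] [CharZero E]

theorem eq_of_derivative_eq {p q : E[X]} (h : derivative p = derivative q)
    (h0 : p.coeff 0 = q.coeff 0) : p = q := by
  ext j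
  rcases j with _ | j
  · exact h0
  · have := congrArg (coeff · j) h
    simp only [coeff_derivative] at this
    exact mul_right_cancel₀ (Nat.cast_add_one_ne_zero j) this

theorem exists_derivative_eq (q : E[X]) : ∃ p : E[X], derivative p = q ∧ p.coeff 0 = 0 := by
  refine ⟨∑ i ∈ q.support, C (q.coeff i / (i + 1)) * X ^ (i + 1), ?_, ?_⟩
  · conv_rhs => rw [q.as_sum_support_C_mul_X_pow]
    refine (derivative_sum).trans (Finset.sum_congr rfl fun i _ => ?_)
    rw [derivative_C_mul_X_pow, Nat.cast_add_one, div_mul_cancel₀ _ (Nat.cast_add_one_ne_zero i),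
      Nat.add_sub_cancel]
  · simp only [finsetSum_coeff, coeff_C_mul_X_pow, (Nat.succ_ne_zero _).symm, if_false,
      Finset.sum_const_zero]

theorem exists_monic_derivative_eq {r : E[X]} (hr : r.Monic) :
    ∃ p : E[X], p.Monic ∧ p.natDegree = r.natDegree + 1 ∧ p.coeff 0 = 0 ∧
      derivative p = C ((r.natDegree + 1 : ℕ) : E) * r := by
  have hcast : ((r.natDegree + 1 : ℕ) : E) ≠ 0 := Nat.cast_ne_zero.2 (Nat.succ_ne_zero _)
  obtain ⟨p, hp, hp0⟩ := exists_derivative_eq (C ((r.natDegree + 1 : ℕ) : E) * r)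
  have hdegree : p.natDegree = r.natDegree + 1 := by
    have hderiv : p.natDegree - 1 = r.natDegree := by
      rw [← natDegree_derivative, hp, natDegree_C_mul hcast]
    have hne : p.natDegree ≠ 0 := fun h => by
      rw [eq_C_of_natDegree_eq_zero h, derivative_C] at hp
      exact mul_ne_zero (C_ne_zero.2 hcast) hr.ne_zero hp.symm
    omega
  refine ⟨p, ?_, hdegree, hp0, hp⟩
  have := congrArg (coeff · r.natDegree) hp
  simp only [coeff_derivative, coeff_C_mul, hr.coeff_natDegree, ← Nat.cast_add_one, mul_one] at this
  rw [Monic, leadingCoeff, hdegree]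
  exact (mul_eq_right₀ hcast).1 this

end Antiderivative

variable {K : Type*} [Field K]

theorem exists_algHom_extending {m : ℕ}
    (τ : MvPolynomial (Fin m) K ≃ₐ[K] MvPolynomial (Fin m) K) :
    ∃ σ : GenericClosure K m →ₐ[K] GenericClosure K m, ∀ r : MvPolynomial (Fin m) K,
      σ (algebraMap _ _ r) = algebraMap _ _ (τ r) := by
  let σ₀ : GenericField K m ≃ₐ[K] GenericField K m :=
    IsFractionRing.fieldEquivOfAlgEquiv K _ _ τ
  let σ₁ := IsAlgClosure.equivOfEquiv (GenericClosure K m) (GenericClosure K m) σ₀.toRingEquiv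
  have hσ₁ (z : GenericField K m) : σ₁ (algebraMap _ _ z) = algebraMap _ _ (σ₀ z) :=
    IsAlgClosure.equivOfEquiv_algebraMap _ _ σ₀.toRingEquiv z
  refine ⟨{ σ₁.toRingHom with commutes' := fun a => ?_ }, fun r => ?_⟩
  · have := hσ₁ (algebraMap K _ a)
    rwa [σ₀.commutes, ← IsScalarTower.algebraMap_apply] at this
  · refine (congrArg σ₁ (IsScalarTower.algebraMap_apply _ (GenericField K m) _ r)).trans ?_
    rw [hσ₁, IsScalarTower.algebraMap_apply _ (GenericField K m) _ (τ r)]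
    exact congrArg _ (IsFractionRing.fieldEquivOfAlgEquiv_algebraMap K _ _ τ r)

variable [CharZero K] {d : ℕ}

theorem IsSpecialization.vertex_injective [NeZero d] {E : Type*} [Field E] [Algebra K E] {p : E[X]}
    {ψ : GenericIntegers K d →+* E} (h : IsSpecialization p ψ) {n : ℕ}
    (hp : (critIter p n).Separable) :
    Function.Injective fun x : GenericVertex K d n => ψ (vertexInteger x) := by
  intro x y hxy
  by_contra hne
  refine hp.eval₂_derivative_ne_zero (RingHom.id E) (x := ψ (vertexInteger x)) ?_ ?_
  · rw [eval₂_id, h.eval_vertex]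
  · rw [eval₂_id, h.derivative_critIter_eq_zero hne hxy]

theorem exists_gal_toPerm_eq_of_critical_points [NeZero d] {E : Type*} [Field E] [CharZero E]
    [IsAlgClosed E] [Algebra K E] {c : Fin (d - 1) → E} (hc : Function.Injective c)
    (hperm : ∀ τ : Equiv.Perm (Fin (d - 1)), ∃ σ : E →ₐ[K] E, ∀ i, σ (c i) = c (τ i))
    (π : Equiv.Perm (GenericVertex K d 0)) :
    ∃ g : Gal(GenericClosure K d/GenericField K d), MulAction.toPerm g = π := by
  have hr : (∏ i, (X - C (c i))).Monic := monic_prod_of_monic _ _ fun i _ => monic_X_sub_C _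
  have hdr : (∏ i, (X - C (c i))).natDegree + 1 = d := by
    rw [natDegree_finsetProd_X_sub_C_eq_card, Finset.card_univ, Fintype.card_fin,
      Nat.sub_add_cancel (NeZero.one_le (n := d))]
  obtain ⟨p, hp, hpd, hp0, hderiv⟩ := exists_monic_derivative_eq hr
  rw [hdr] at hpd hderiv
  have hdE : (d : E) ≠ 0 := Nat.cast_ne_zero.2 (NeZero.ne d)
  have hcrit : critIter p 0 = C (d : E) * ∏ i, (X - C (c i)) := by
    rw [critIter, Function.iterate_zero_apply, comp_X, hderiv]
  have hroot (e : E) : (critIter p 0).eval e = 0 ↔ e ∈ Set.range c := by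
    rw [hcrit, eval_mul, eval_C, mul_eq_zero, or_iff_right hdE, eval_prod, Finset.prod_eq_zero_iff]
    simp only [Finset.mem_univ, true_and, eval_sub, eval_X, eval_C, sub_eq_zero, eq_comm (a := e),
      Set.mem_range]
  have hsep : (critIter p 0).Separable := by
    rw [hcrit]
    exact (separable_prod_X_sub_C_iff.2 hc).unit_mul (isUnit_C.2 hdE.isUnit)
  obtain ⟨ψ, h⟩ := exists_isSpecialization (K := K) hp hpd
  have hinj := h.vertex_injective hsep
  have hrange : Set.range (fun x : GenericVertex K d 0 => ψ (vertexInteger x)) = Set.range c := by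
    ext e
    rw [← hroot]
    exact ⟨by rintro ⟨x, rfl⟩; exact h.eval_vertex x, h.exists_vertex_eq hsep.ne_zero⟩
  let e : GenericVertex K d 0 ≃ Fin (d - 1) := (Equiv.ofInjective _ hinj).trans
    ((Equiv.setCongr hrange).trans (Equiv.ofInjective c hc).symm)
  have he (x) : c (e x) = ψ (vertexInteger x) := Equiv.apply_ofInjective_symm hc _
  obtain ⟨σ, hσ⟩ := hperm (e.permCongr π)
  have hpσ : p.map (σ : E →+* E) = p := by
    refine eq_of_derivative_eq ?_ (by rw [coeff_map, hp0, map_zero])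
    rw [derivative_map, hderiv, Polynomial.map_mul, map_C, map_natCast, Polynomial.map_prod,
      ← Equiv.prod_comp (e.permCongr π) fun i => X - C (c i)]
    simp only [Polynomial.map_sub, map_X, map_C, RingHom.coe_coe, hσ]
  obtain ⟨g, hg⟩ := h.exists_gal_lifting_algHom σ hpσ 0
  refine ⟨g, Equiv.ext fun x => hinj ?_⟩
  change ψ (vertexInteger (g • x)) = ψ (vertexInteger (π x))
  rw [hg, ← he, ← he, hσ, Equiv.permCongr_apply, Equiv.symm_apply_apply]

theorem exists_gal_toPerm_eq_critical_points [NeZero d] (π : Equiv.Perm (GenericVertex K d 0)) :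
    ∃ g : Gal(GenericClosure K d/GenericField K d), MulAction.toPerm g = π := by
  let c (i : Fin (d - 1)) : GenericClosure K (d - 1) := algebraMap _ _ (MvPolynomial.X (R := K) i)
  have hc : Function.Injective c :=
    (FaithfulSMul.algebraMap_injective _ (GenericClosure K (d - 1))).comp MvPolynomial.X_injective
  refine exists_gal_toPerm_eq_of_critical_points hc (fun τ => ?_) π
  obtain ⟨σ, hσ⟩ := exists_algHom_extending (MvPolynomial.renameEquiv K τ)
  refine ⟨σ, fun i => ?_⟩
  rw [hσ, MvPolynomial.renameEquiv_apply, MvPolynomial.rename_X]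

end CriticalPoints

section Orbit

theorem second_derivative_eq_zero_of_map_eq {A B : Type*} [CommRing A] [IsDomain A] [CommRing B]
    (φ : A →+* B) {q : A[X]} {x c : A} (hx : q.eval x = q.eval c) (hc : (derivative q).eval c = 0)
    (hxc : x ≠ c) (h : φ x = φ c) : (derivative (derivative (q.map φ))).eval (φ c) = 0 := by
  obtain ⟨r, hr⟩ : X - C c ∣ q - C (q.eval c) := X_sub_C_dvd_sub_C_eval
  rw [sub_eq_iff_eq_add] at hr
  have hrc : r.eval c = 0 := by
    rw [hr] at hc
    simpa using hc
  have hrx : r.eval x = 0 := by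
    have := congrArg (eval x) hr
    simpa [hx, sub_eq_zero, hxc] using this
  have hr' : (derivative (r.map φ)).eval (φ c) = 0 :=
    derivative_eval_eq_zero_of_map_eq φ hrc hrx hxc.symm h.symm
  rw [derivative_map, eval_map_apply] at hr'
  rw [hr]
  simp [hr']

theorem mul_sub_dvd_orbit_sub {A : Type*} [CommRing A] {q : A[X]} {b c : A} {z : ℕ → A}
    (hz : ∀ j, z (j + 1) = b * q.eval (z j) + c) (j m : ℕ) :
    b * (z (j + 1) - z j) ∣ z (j + 1 + m) - z (j + 1) := by
  have hstep (i : ℕ) : b * (z (i + 1) - z i) ∣ z (i + 2) - z (i + 1) := by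
    rw [hz (i + 1), hz i, add_sub_add_right_eq_sub, ← mul_sub, ← hz i]
    exact mul_dvd_mul_left b (sub_dvd_eval_sub _ _ q)
  have hsteps (m : ℕ) : b * (z (j + 1) - z j) ∣ z (j + m + 2) - z (j + m + 1) := by
    induction m with
    | zero => exact hstep j
    | succ m ih => exact ih.trans ((Dvd.intro_left b rfl).trans (hstep (j + m + 1)))
  induction m with
  | zero => simp
  | succ m ih =>
    have := dvd_add (hsteps m) ih
    rwa [show j + m + 1 = j + 1 + m by ring, show j + m + 2 = j + 1 + (m + 1) by ring,
      sub_add_sub_cancel] at this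

variable {k : Type*} [Field k] {q : (PowerSeries k)[X]} {b : PowerSeries k}

/-- The starting point of the orbit is a Hensel root: modulo the maximal ideal every step of the
orbit stays at `c`. -/
theorem exists_orbit_critical (hb : PowerSeries.constantCoeff b = 0) {c : k}
    (hc : (derivative (q.map PowerSeries.constantCoeff)).eval c = 0)
    (hc' : (derivative (derivative (q.map PowerSeries.constantCoeff))).eval c ≠ 0) (n : ℕ) :
    ∃ z : ℕ → PowerSeries k, (∀ j, z (j + 1) = b * q.eval (z j) + z 0) ∧
      PowerSeries.constantCoeff (z 0) = c ∧ (derivative q).eval (z n) = 0 := by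
  let Z : ℕ → (PowerSeries k)[X] := fun j => (fun P => C b * q.comp P + X)^[j] X
  have hZ (j : ℕ) : Z (j + 1) = C b * q.comp (Z j) + X := Function.iterate_succ_apply' _ _ _
  have hZmap (j : ℕ) : (Z j).map PowerSeries.constantCoeff = X := by
    cases j with
    | zero => exact map_X _
    | succ j => simp [hZ, hb]
  have hmap : ((derivative q).comp (Z n)).map PowerSeries.constantCoeff =
      derivative (q.map PowerSeries.constantCoeff) := by
    rw [Polynomial.map_comp, hZmap, comp_X, ← derivative_map]
  obtain ⟨τ, hτ, hτc⟩ := exists_powerSeries_root ((derivative q).comp (Z n)) (a₀ := c)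
    (by rwa [hmap]) (by rwa [hmap])
  refine ⟨fun j => (Z j).eval τ, fun j => ?_, ?_, by rwa [← eval_comp]⟩
  · simp [hZ, eval_comp, Z]
  · simpa [Z] using hτc

variable {z : ℕ → PowerSeries k} (hb : PowerSeries.constantCoeff b = 0)
  (hz : ∀ j, z (j + 1) = b * q.eval (z j) + z 0)

include hb hz

theorem constantCoeff_orbit (j : ℕ) :
    PowerSeries.constantCoeff (z j) = PowerSeries.constantCoeff (z 0) := by
  cases j with
  | zero => rfl
  | succ j => rw [hz, map_add, map_mul, hb, zero_mul, zero_add]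

variable (hc' : (derivative (derivative (q.map PowerSeries.constantCoeff))).eval
  (PowerSeries.constantCoeff (z 0)) ≠ 0)

include hc'

theorem eval_second_derivative_orbit_ne_zero (j : ℕ) :
    (derivative (derivative q)).eval (z j) ≠ 0 := by
  intro h
  refine hc' ?_
  rw [← constantCoeff_orbit hb hz j, derivative_map, derivative_map, eval_map_apply, h, map_zero]

theorem orbit_succ_ne (hb0 : b ≠ 0)
    (hqc : (q.map PowerSeries.constantCoeff).eval (PowerSeries.constantCoeff (z 0)) ≠ 0)
    {j : ℕ} (hj : (derivative q).eval (z j) = 0) : z (j + 1) ≠ z j := by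
  induction j with
  | zero =>
    intro h
    rw [hz, add_eq_right, mul_eq_zero] at h
    rw [eval_map_apply, h.resolve_left hb0, map_zero] at hqc
    exact hqc rfl
  | succ j ih =>
    intro h
    have hq : q.eval (z j) = q.eval (z (j + 1)) := by
      rw [hz (j + 1), hz j] at h
      rw [hz j]
      exact (mul_left_cancel₀ hb0 (add_right_cancel h)).symm
    have heq : z j = z (j + 1) := by
      by_contra hne
      refine hc' ?_
      rw [← constantCoeff_orbit hb hz (j + 1)]
      exact second_derivative_eq_zero_of_map_eq _ hq hj hne
        (by rw [constantCoeff_orbit hb hz, constantCoeff_orbit hb hz (j + 1)])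
    exact ih (heq ▸ hj) heq.symm

theorem eval_derivative_orbit_ne_zero (hb0 : b ≠ 0)
    (hqc : (q.map PowerSeries.constantCoeff).eval (PowerSeries.constantCoeff (z 0)) ≠ 0)
    {n : ℕ} (hn : (derivative q).eval (z n) = 0) {j : ℕ} (hj : j < n) :
    (derivative q).eval (z j) ≠ 0 := by
  intro hcj
  have hjn : z n = z j := by
    by_contra hne
    refine hc' ?_
    rw [derivative_map, ← constantCoeff_orbit hb hz n]
    exact derivative_eval_eq_zero_of_map_eq _ hn hcj hne
      (by rw [constantCoeff_orbit hb hz, constantCoeff_orbit hb hz j])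
  obtain ⟨m, rfl⟩ : ∃ m, n = j + 1 + m := ⟨n - (j + 1), by omega⟩
  obtain ⟨w, hw⟩ := mul_sub_dvd_orbit_sub hz j m
  rw [hjn] at hw
  have hprod : (z (j + 1) - z j) * (1 + b * w) = 0 := by linear_combination -hw
  have hunit : 1 + b * w ≠ 0 := fun h => by simpa [hb] using congrArg PowerSeries.constantCoeff h
  exact orbit_succ_ne hb hz hc' hb0 hqc hcj
    (sub_eq_zero.1 ((mul_eq_zero.1 hprod).resolve_right hunit))

end Orbit

section Cluster

/-- The polynomial `x ((x - 1)^(e+1) - a)`, whose non-zero roots cluster at `1` as `a` tends to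
`0`. -/
def clusterPoly {A : Type*} [CommRing A] (e : ℕ) (a : A) : A[X] :=
  X * ((X - 1) ^ (e + 1) - C a)

theorem map_clusterPoly {A B : Type*} [CommRing A] [CommRing B] (φ : A →+* B) (e : ℕ) (a : A) :
    (clusterPoly e a).map φ = clusterPoly e (φ a) := by
  simp [clusterPoly]

variable {k : Type*} [Field k]

theorem derivative_clusterPoly_zero (e : ℕ) :
    derivative (clusterPoly e (0 : k)) = (X - 1) ^ e * (C (e + 2 : k) * X - 1) := by
  simp only [clusterPoly, C_0, sub_zero, derivative_mul, derivative_X, derivative_pow,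
    derivative_sub, derivative_one, map_add, Nat.add_sub_cancel, map_natCast, Nat.cast_add,
    Nat.cast_one, map_one, C_ofNat]
  ring

variable [CharZero k]

theorem one_div_add_two_sub_one_ne_zero (e : ℕ) : (1 / (e + 2) : k) - 1 ≠ 0 := by
  rw [sub_ne_zero, ne_eq, div_eq_one_iff_eq (by exact_mod_cast (e + 1).succ_ne_zero)]
  exact_mod_cast show (1 : ℕ) ≠ e + 2 by omega

theorem eval_derivative_clusterPoly_zero (e : ℕ) :
    (derivative (clusterPoly e (0 : k))).eval (1 / (e + 2) : k) = 0 := by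
  have he : (e + 2 : k) ≠ 0 := by exact_mod_cast (e + 1).succ_ne_zero
  simp [derivative_clusterPoly_zero, he]

theorem eval_second_derivative_clusterPoly_zero_ne_zero (e : ℕ) :
    (derivative (derivative (clusterPoly e (0 : k)))).eval (1 / (e + 2) : k) ≠ 0 := by
  have he : (e + 2 : k) ≠ 0 := by exact_mod_cast (e + 1).succ_ne_zero
  have heval : (derivative (derivative (clusterPoly e (0 : k)))).eval (1 / (e + 2) : k) =
      ((1 / (e + 2) : k) - 1) ^ e * (e + 2) := by
    rw [derivative_clusterPoly_zero, derivative_mul, eval_add, eval_mul, eval_mul]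
    simp [he]
  rw [heval]
  exact mul_ne_zero (pow_ne_zero _ (one_div_add_two_sub_one_ne_zero e)) he

theorem eval_clusterPoly_zero_ne_zero (e : ℕ) :
    (clusterPoly e (0 : k)).eval (1 / (e + 2) : k) ≠ 0 := by
  have he : (e + 2 : k) ≠ 0 := by exact_mod_cast (e + 1).succ_ne_zero
  simp only [clusterPoly, eval_mul, eval_X, C_0, sub_zero, eval_pow, eval_sub, eval_one]
  exact mul_ne_zero (one_div_ne_zero he) (pow_ne_zero _ (one_div_add_two_sub_one_ne_zero e))

variable (k) in
theorem exists_orbit_clusterPoly (e n : ℕ) : ∃ z : ℕ → PowerSeries k,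
    (∀ j, z (j + 1) = PowerSeries.X ^ (e + 1) *
      (clusterPoly e (PowerSeries.X : PowerSeries k)).eval (z j) + z 0) ∧
    (derivative (clusterPoly e (PowerSeries.X : PowerSeries k))).eval (z n) = 0 ∧
    (derivative (derivative (clusterPoly e (PowerSeries.X : PowerSeries k)))).eval (z n) ≠ 0 ∧
    ∀ j < n, (derivative (clusterPoly e (PowerSeries.X : PowerSeries k))).eval (z j) ≠ 0 := by
  have hmap : (clusterPoly e (PowerSeries.X : PowerSeries k)).map PowerSeries.constantCoeff =
      clusterPoly e 0 := by
    rw [map_clusterPoly, PowerSeries.constantCoeff_X]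
  have hb : PowerSeries.constantCoeff (PowerSeries.X ^ (e + 1) : PowerSeries k) = 0 := by simp
  have hc' := eval_second_derivative_clusterPoly_zero_ne_zero (k := k) e
  have hqc := eval_clusterPoly_zero_ne_zero (k := k) e
  rw [← hmap] at hc' hqc
  obtain ⟨z, hz, hz0, hzn⟩ := exists_orbit_critical hb
    (by rw [hmap]; exact eval_derivative_clusterPoly_zero e) hc' n
  rw [← hz0] at hc' hqc
  exact ⟨z, hz, hzn, eval_second_derivative_orbit_ne_zero hb hz hc' n, fun j hj =>
    eval_derivative_orbit_ne_zero hb hz hc' (pow_ne_zero _ PowerSeries.X_ne_zero) hqc hzn hj⟩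

end Cluster

section SiblingPoly

/-- The polynomial `x ((x - a)^(e+1) - a^(e+2)) + t`. Its fibre over `t` consists of `0` and of the
points `a + a w` with `w^(e+1) = a`. -/
def siblingPoly {A : Type*} [CommRing A] (e : ℕ) (a t : A) : A[X] :=
  X * ((X - C a) ^ (e + 1) - C (a ^ (e + 2))) + C t

variable {A B : Type*} [CommRing A] [CommRing B]

theorem map_siblingPoly (φ : A →+* B) (e : ℕ) (a t : A) :
    (siblingPoly e a t).map φ = siblingPoly e (φ a) (φ t) := by
  simp [siblingPoly]

theorem siblingPoly_comp (e : ℕ) (a t : A) :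
    (siblingPoly e a t).comp (C a * X) = C (a ^ (e + 2)) * clusterPoly e a + C t := by
  have hshift : (C a * X - C a : A[X]) = C a * (X - 1) := by ring
  simp only [siblingPoly, clusterPoly, add_comp, mul_comp, X_comp, sub_comp, pow_comp, C_comp,
    hshift, mul_pow, map_pow]
  ring

theorem eval_siblingPoly (e : ℕ) (a t z : A) :
    (siblingPoly e a t).eval (a * z) = a ^ (e + 2) * (clusterPoly e a).eval z + t := by
  simpa [eval_comp] using congrArg (eval z) (siblingPoly_comp e a t)

theorem eval_derivative_siblingPoly (e : ℕ) (a t z : A) :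
    a * (derivative (siblingPoly e a t)).eval (a * z) =
      a ^ (e + 2) * (derivative (clusterPoly e a)).eval z := by
  simpa [eval_comp, derivative_comp, derivative_pow] using
    congrArg (fun r => (derivative r).eval z) (siblingPoly_comp e a t)

theorem eval_second_derivative_siblingPoly (e : ℕ) (a t z : A) :
    a * (a * (derivative (derivative (siblingPoly e a t))).eval (a * z)) =
      a ^ (e + 2) * (derivative (derivative (clusterPoly e a))).eval z := by
  simpa [eval_comp, derivative_comp, derivative_mul, derivative_pow] using
    congrArg (fun r => (derivative (derivative r)).eval z) (siblingPoly_comp e a t)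

theorem eval_zero_siblingPoly (e : ℕ) (a t : A) : (siblingPoly e a t).eval 0 = t := by
  simp [siblingPoly]

theorem eval_zero_derivative_siblingPoly (e : ℕ) (a t : A) :
    (derivative (siblingPoly e a t)).eval 0 = a ^ (e + 1) * ((-1) ^ (e + 1) - a) := by
  simp only [siblingPoly, derivative_mul, derivative_add, derivative_X, derivative_C, eval_add,
    eval_mul, eval_sub, eval_pow, eval_X, eval_C, one_mul, zero_mul, add_zero]
  rw [zero_sub, neg_pow]
  ring

theorem iterate_siblingPoly {e : ℕ} {a : A} {z : ℕ → A}
    (hz : ∀ j, z (j + 1) = a ^ (e + 1) * (clusterPoly e a).eval (z j) + z 0) (j : ℕ) :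
    (fun y => (siblingPoly e a (a * z 0)).eval y)^[j + 1] 0 = a * z j := by
  induction j with
  | zero => exact eval_zero_siblingPoly e a _
  | succ j ih =>
    rw [Function.iterate_succ_apply', ih, eval_siblingPoly, hz j]
    ring

theorem monic_natDegree_siblingPoly [Nontrivial A] (e : ℕ) (a t : A) :
    (siblingPoly e a t).Monic ∧ (siblingPoly e a t).natDegree = e + 2 := by
  have hpow : ((X - C a) ^ (e + 1) : A[X]).Monic := (monic_X_sub_C a).pow _
  have hpow_deg : ((X - C a) ^ (e + 1) : A[X]).natDegree = e + 1 := by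
    rw [(monic_X_sub_C a).natDegree_pow, natDegree_X_sub_C, mul_one]
  have hsub : ((X - C a) ^ (e + 1) - C (a ^ (e + 2)) : A[X]).Monic := by
    refine hpow.sub_of_left (degree_C_le.trans_lt ?_)
    rw [← natDegree_pos_iff_degree_pos, hpow_deg]
    exact e.succ_pos
  have hmul_deg : (X * ((X - C a) ^ (e + 1) - C (a ^ (e + 2))) : A[X]).natDegree = e + 2 := by
    rw [monic_X.natDegree_mul hsub, natDegree_X, natDegree_sub_C, hpow_deg]
    ring
  refine ⟨(monic_X.mul hsub).add_of_left (degree_C_le.trans_lt ?_),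
    by rw [siblingPoly, natDegree_add_C, hmul_deg]⟩
  rw [← natDegree_pos_iff_degree_pos, hmul_deg]
  exact (e + 1).succ_pos

theorem exists_root_critIter_siblingPoly (K : Type*) [Field K] [CharZero K] (e n : ℕ) :
    ∃ t : PowerSeries K, (critIter (siblingPoly e PowerSeries.X t) (n + 1)).eval 0 = 0 ∧
      (derivative (critIter (siblingPoly e PowerSeries.X t) (n + 1))).eval 0 ≠ 0 := by
  obtain ⟨z, hz, hzn, hzn', hzj⟩ := exists_orbit_clusterPoly K e n
  have ha : (PowerSeries.X : PowerSeries K) ≠ 0 := PowerSeries.X_ne_zero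
  refine ⟨PowerSeries.X * z 0, ?_, ?_⟩
  · rw [eval_critIter, iterate_siblingPoly hz, ← mul_right_inj' ha, eval_derivative_siblingPoly,
      hzn, mul_zero, mul_zero]
  rw [eval_derivative_critIter, iterate_siblingPoly hz]
  refine mul_ne_zero (Finset.prod_ne_zero_iff.2 fun j hj => ?_) fun h => ?_
  · rw [eval_critIter]
    cases j with
    | zero =>
      rw [Function.iterate_zero_apply, eval_zero_derivative_siblingPoly]
      refine mul_ne_zero (pow_ne_zero _ ha) fun h => ?_
      simpa using congrArg PowerSeries.constantCoeff h
    | succ j =>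
      rw [iterate_siblingPoly hz, ← mul_ne_zero_iff_left ha, eval_derivative_siblingPoly]
      exact mul_ne_zero (pow_ne_zero _ ha) (hzj j (by simpa using hj))
  · have := eval_second_derivative_siblingPoly e PowerSeries.X (PowerSeries.X * z 0) (z n)
    rw [h, mul_zero, mul_zero] at this
    exact mul_ne_zero (pow_ne_zero _ ha) hzn' this.symm

variable {E : Type*} [Field E] {e : ℕ} {a t : E}

theorem exists_pow_eq_of_eval_siblingPoly_eq (ha : a ≠ 0) {y : E}
    (hy : (siblingPoly e a t).eval y = t) (hy0 : y ≠ 0) :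
    ∃ w : E, w ^ (e + 1) = a ∧ y = a + a * w := by
  have hroot : y * ((y - a) ^ (e + 1) - a ^ (e + 2)) = 0 := by simpa [siblingPoly] using hy
  refine ⟨(y - a) / a, ?_, by field_simp; ring⟩
  rw [div_pow, sub_eq_zero.1 ((mul_eq_zero.1 hroot).resolve_left hy0), pow_succ a (e + 1),
    mul_div_cancel_left₀ _ (pow_ne_zero _ ha)]

theorem eval_derivative_siblingPoly_ne_zero [CharZero E] (ha : a ≠ 0) {w : E}
    (hw : w ^ (e + 1) = a) (hy0 : a + a * w ≠ 0) :
    (derivative (siblingPoly e a t)).eval (a + a * w) ≠ 0 := by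
  have hw0 : w ≠ 0 := by
    rintro rfl
    exact ha (hw ▸ zero_pow e.succ_ne_zero)
  have hpow : (a * w) ^ (e + 1) = a ^ (e + 2) := by rw [mul_pow, hw, pow_succ a (e + 1)]
  have heval : (derivative (siblingPoly e a t)).eval (a + a * w) =
      (a + a * w) * ((e + 1) * (a * w) ^ e) := by
    simp [siblingPoly, derivative_mul, derivative_pow, hpow]
  rw [heval]
  exact mul_ne_zero hy0 (mul_ne_zero (by exact_mod_cast e.succ_ne_zero)
    (pow_ne_zero _ (mul_ne_zero ha hw0)))

end SiblingPoly

section Siblings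

theorem irreducible_X_pow_sub_C_of_prime {R F : Type*} [CommRing R] [IsDomain R]
    [IsIntegrallyClosed R] [Field F] [Algebra R F] [IsFractionRing R F] {π : R} (hπ : Prime π)
    (m : ℕ) : Irreducible (X ^ (m + 1) - C (algebraMap R F π)) := by
  have hmonic : (X ^ (m + 1) - C π).Monic := monic_X_pow_sub_C _ m.succ_ne_zero
  have hdeg : (X ^ (m + 1) - C π).natDegree = m + 1 := natDegree_X_pow_sub_C
  have heisenstein : (X ^ (m + 1) - C π).IsEisensteinAt (Ideal.span {π}) := by
    refine ⟨?_, fun {i} hi => ?_, ?_⟩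
    · rw [hmonic.leadingCoeff, Ideal.mem_span_singleton]
      exact fun h => hπ.not_isUnit (isUnit_of_dvd_one h)
    · rw [hdeg] at hi
      rw [coeff_sub, coeff_X_pow, if_neg hi.ne, coeff_C, zero_sub, neg_mem_iff]
      split_ifs
      · exact Ideal.mem_span_singleton_self π
      · exact zero_mem _
    · rw [Ideal.span_singleton_pow, Ideal.mem_span_singleton, coeff_sub, coeff_X_pow,
        if_neg m.succ_ne_zero.symm, coeff_C_zero, zero_sub, dvd_neg, pow_two]
      intro h
      nth_rw 3 [← mul_one π] at h
      exact hπ.not_isUnit (isUnit_of_dvd_one ((mul_dvd_mul_iff_left hπ.ne_zero).1 h))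
  have hirr := heisenstein.irreducible ((Ideal.span_singleton_prime hπ.ne_zero).2 hπ)
    hmonic.isPrimitive (hdeg.symm ▸ m.succ_pos)
  simpa using (hmonic.irreducible_iff_irreducible_map_fraction_map (K := F)).1 hirr

theorem exists_algEquiv_of_irreducible {k E : Type*} [Field k] [Field E] [Algebra k E] [Normal k E]
    {p : k[X]} (hp : Irreducible p) {w w' : E} (hw : aeval w p = 0) (hw' : aeval w' p = 0) :
    ∃ σ : E ≃ₐ[k] E, σ w = w' := by
  refine minpoly.exists_algEquiv_of_root' (Algebra.IsAlgebraic.isAlgebraic w) ?_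
  rw [← minpoly.eq_of_irreducible hp hw, map_mul, hw', zero_mul]

variable {K : Type*} [Field K] [CharZero K]

theorem IsSpecialization.eq_of_map_eq {E : Type*} [Field E] [Algebra K E] {d n : ℕ} [NeZero d]
    {p : E[X]} {ψ : GenericIntegers K d →+* E} (h : IsSpecialization p ψ)
    {x y : GenericVertex K d n}
    (hx : (derivative (critIter p n)).eval (ψ (vertexInteger x)) ≠ 0)
    (hxy : ψ (vertexInteger x) = ψ (vertexInteger y)) : x = y := by
  by_contra hne
  exact hx (h.derivative_critIter_eq_zero hne hxy)

variable {k E : Type*} [Field k] [Field E] [CharZero E] [IsAlgClosed E] [Algebra k E] [Normal k E]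
  [Algebra K k] [Algebra K E] [IsScalarTower K k E] {e n : ℕ} {a t : k}

/-- The vertex `x` is the one specializing to the fixed point `0` of all automorphisms. -/
theorem exists_gal_fix_of_specialization (ha : a ≠ 0) (hirr : Irreducible (X ^ (e + 1) - C a))
    (h0 : (critIter (siblingPoly e (algebraMap k E a) (algebraMap k E t)) (n + 1)).eval 0 = 0)
    (h1 : (derivative
      (critIter (siblingPoly e (algebraMap k E a) (algebraMap k E t)) (n + 1))).eval 0 ≠ 0) :
    ∃ x : GenericVertex K (e + 2) (n + 1), ∀ y y' : GenericVertex K (e + 2) (n + 1),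
      y ≠ x → y' ≠ x → parent y = parent x → parent y' = parent x →
      ∃ g : Gal(GenericClosure K (e + 2)/GenericField K (e + 2)), g • x = x ∧ g • y = y' := by
  set α := algebraMap k E a
  have hα : α ≠ 0 := (_root_.map_ne_zero _).2 ha
  obtain ⟨hmonic, hdeg⟩ := monic_natDegree_siblingPoly e α (algebraMap k E t)
  obtain ⟨ψ, hψ⟩ := exists_isSpecialization (K := K) hmonic hdeg
  obtain ⟨x, hx⟩ := hψ.exists_vertex_eq (fun h => h1 (by rw [h, derivative_zero, eval_zero])) h0
  have hunique (y) (hy : ψ (vertexInteger y) = 0) : y = x :=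
    (hψ.eq_of_map_eq (by rwa [hx]) (hx.trans hy.symm)).symm
  have hsibling (y : GenericVertex K (e + 2) (n + 1)) (hyx : y ≠ x) (hy : parent y = parent x) :
      ∃ w : E, w ^ (e + 1) = α ∧ ψ (vertexInteger y) = α + α * w := by
    refine exists_pow_eq_of_eval_siblingPoly_eq hα (t := algebraMap k E t) ?_ (mt (hunique y) hyx)
    rw [hψ.eval_vertex_eq_parent, hy, ← hψ.eval_vertex_eq_parent, hx, eval_zero_siblingPoly]
  refine ⟨x, fun y y' hyx hy'x hy hy' => ?_⟩
  obtain ⟨w, hw, hyw⟩ := hsibling y hyx hy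
  obtain ⟨w', hw', hyw'⟩ := hsibling y' hy'x hy'
  obtain ⟨σ, hσ⟩ := exists_algEquiv_of_irreducible hirr (w := w) (w' := w')
    (by simp [hw, α]) (by simp [hw', α])
  obtain ⟨g, hg⟩ := hψ.exists_gal_lifting_algHom (σ.toAlgHom.restrictScalars K)
    ((map_siblingPoly _ e _ _).trans (congrArg₂ _ (σ.commutes a) (σ.commutes t))) (n + 1)
  have hgx : g • x = x := hunique _ (by rw [hg, hx, map_zero])
  have hgy : ψ (vertexInteger (g • y)) = ψ (vertexInteger y') := by
    rw [hg, hyw, hyw', ← hσ]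
    exact (map_add σ _ _).trans (by rw [map_mul, σ.commutes])
  refine ⟨g, hgx, ?_⟩
  by_contra hne
  have hcrit := hψ.derivative_eq_zero_of_parent_eq
    (by rw [parent_smul, hy, ← parent_smul, hgx, hy']) hne hgy
  rw [hgy, hyw'] at hcrit
  exact eval_derivative_siblingPoly_ne_zero hα hw' (hyw' ▸ mt (hunique y') hy'x) hcrit

variable (K) in
theorem exists_vertex_stabilizer_transitive (e n : ℕ) :
    ∃ x : GenericVertex K (e + 2) (n + 1), ∀ y y' : GenericVertex K (e + 2) (n + 1),
      y ≠ x → y' ≠ x → parent y = parent x → parent y' = parent x →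
      ∃ g : Gal(GenericClosure K (e + 2)/GenericField K (e + 2)), g • x = x ∧ g • y = y' := by
  let k := FractionRing (PowerSeries K)
  let E := AlgebraicClosure k
  have hk : Function.Injective (algebraMap (PowerSeries K) k) := IsFractionRing.injective _ k
  have hE : Function.Injective (algebraMap (PowerSeries K) E) :=
    (algebraMap k E).injective.comp hk
  have : CharZero (PowerSeries K) := charZero_of_injective_algebraMap PowerSeries.C_injective
  have : CharZero E := charZero_of_injective_algebraMap hE
  obtain ⟨t, ht, ht'⟩ := exists_root_critIter_siblingPoly K e n
  have hmap : (critIter (siblingPoly e PowerSeries.X t) (n + 1)).map (algebraMap _ E) =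
      critIter (siblingPoly e (algebraMap k E (algebraMap (PowerSeries K) k PowerSeries.X))
        (algebraMap k E (algebraMap (PowerSeries K) k t))) (n + 1) := by
    rw [map_critIter, map_siblingPoly]
    rfl
  refine exists_gal_fix_of_specialization (E := E) (a := algebraMap (PowerSeries K) k PowerSeries.X)
    (t := algebraMap _ k t) ((map_ne_zero_iff _ hk).2 PowerSeries.X_ne_zero)
    (irreducible_X_pow_sub_C_of_prime PowerSeries.X_prime e) ?_ ?_
  · rw [← hmap, ← map_zero (algebraMap (PowerSeries K) E), eval_map_apply, ht, map_zero]
  · rw [← hmap, derivative_map, ← map_zero (algebraMap (PowerSeries K) E), eval_map_apply]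
    exact hE.ne ht'

theorem exists_gal_fix_smul_sibling_eq {d : ℕ} (hd : 2 ≤ d) {x y y' : GenericVertex K d (n + 1)}
    (hyx : y ≠ x) (hy'x : y' ≠ x) (hy : parent y = parent x) (hy' : parent y' = parent x) :
    ∃ g : Gal(GenericClosure K d/GenericField K d), g • x = x ∧ g • y = y' := by
  obtain ⟨e, rfl⟩ : ∃ e, d = e + 2 := ⟨d - 2, by omega⟩
  have := isPretransitive_genericVertex K hd (n + 1)
  obtain ⟨x₀, hx₀⟩ := exists_vertex_stabilizer_transitive K e n
  obtain ⟨h, rfl⟩ := MulAction.exists_smul_eq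
    Gal(GenericClosure K (e + 2)/GenericField K (e + 2)) x₀ x
  have hparent (v : GenericVertex K (e + 2) (n + 1)) (hv : parent v = parent (h • x₀)) :
      parent (h⁻¹ • v) = parent x₀ := by
    rw [parent_smul, hv, parent_smul, inv_smul_smul]
  obtain ⟨g, hgx, hgy⟩ := hx₀ (h⁻¹ • y) (h⁻¹ • y') (mt inv_smul_eq_iff.1 hyx)
    (mt inv_smul_eq_iff.1 hy'x) (hparent y hy) (hparent y' hy')
  refine ⟨h * g * h⁻¹, ?_, ?_⟩
  · rw [mul_smul, mul_smul, inv_smul_smul, hgx]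
  · rw [mul_smul, mul_smul, hgy, smul_inv_smul]

end Siblings

section DoubleRoot

theorem irreducible_map_of_natDegree_two {R F : Type*} [CommRing R] [IsDomain R]
    [IsIntegrallyClosed R] [Field F] [Algebra R F] [IsFractionRing R F] {Q : R[X]}
    (hQ : Q.natDegree = 2) (hlead : IsUnit Q.leadingCoeff) (hroot : ∀ r, Q.eval r ≠ 0) :
    Irreducible (Q.map (algebraMap R F)) := by
  have hinj := IsFractionRing.injective R F
  have hdeg : (Q.map (algebraMap R F)).natDegree = 2 := by
    rw [natDegree_map_eq_of_injective hinj, hQ]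
  refine irreducible_of_degree_le_three_of_not_isRoot (by simp [hdeg]) fun x hx => ?_
  obtain ⟨u, hu⟩ := hlead
  have hint : IsIntegral R x := by
    refine ⟨C (↑u⁻¹ : R) * Q, ?_, ?_⟩
    · rw [Monic, leadingCoeff_mul, leadingCoeff_C, ← hu, Units.inv_mul]
    · rw [eval₂_mul, ← eval_map (algebraMap R F) (p := Q), hx.eq_zero, mul_zero]
  obtain ⟨r, rfl⟩ := IsIntegrallyClosed.isIntegral_iff.1 hint
  refine hroot r (hinj ?_)
  rw [← eval_map_apply, hx.eq_zero, map_zero]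

theorem exists_algEquiv_swap_of_natDegree_two {k E : Type*} [Field k] [CharZero k] [Field E]
    [Algebra k E] [IsAlgClosed E] [Normal k E] {p : k[X]} (hp : Irreducible p)
    (hdeg : p.natDegree = 2) : ∃ (ρ₁ ρ₂ : E) (σ : E ≃ₐ[k] E), ρ₁ ≠ ρ₂ ∧
      (∀ z, aeval z p = 0 ↔ z = ρ₁ ∨ z = ρ₂) ∧ σ ρ₁ = ρ₂ ∧ σ ρ₂ = ρ₁ := by
  have hcard : (p.rootSet E).ncard = 2 := by
    rw [← Nat.card_coe_set_eq, Nat.card_eq_fintype_card,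
      card_rootSet_eq_natDegree hp.separable (IsAlgClosed.splits _), hdeg]
  obtain ⟨ρ₁, ρ₂, hne, hρ⟩ := Set.ncard_eq_two.1 hcard
  have hroots (z : E) : aeval z p = 0 ↔ z = ρ₁ ∨ z = ρ₂ := by
    rw [← Set.mem_insert_iff.trans (or_congr_right Set.mem_singleton_iff), ← hρ,
      mem_rootSet_of_ne hp.ne_zero]
  obtain ⟨σ, hσ⟩ := exists_algEquiv_of_irreducible hp ((hroots ρ₁).2 (Or.inl rfl))
    ((hroots ρ₂).2 (Or.inr rfl))
  refine ⟨ρ₁, ρ₂, σ, hne, hroots, hσ, ((hroots _).1 ?_).resolve_right fun h => hne ?_⟩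
  · rw [aeval_algHom_apply, (hroots ρ₂).2 (Or.inr rfl), map_zero]
  · exact σ.injective (hσ.trans h.symm)

theorem rootMultiplicity_eq_derivative_add_one {L : Type*} [Field L] [CharZero L] {p : L[X]}
    (hp : p ≠ 0) {x : L} (hx : p.eval x = 0) :
    p.rootMultiplicity x = (derivative p).rootMultiplicity x + 1 := by
  rw [derivative_rootMultiplicity_of_root hx,
    Nat.sub_add_cancel ((rootMultiplicity_pos hp).2 hx)]

variable {L : Type*} [Field L]

/-- The polynomial `p` has `0` as a double root and no other multiple roots. -/
structure HasOnlyDoubleRootZero (p : L[X]) : Prop where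
  eval_zero : p.eval 0 = 0
  eval_derivative_zero : (derivative p).eval 0 = 0
  eval_second_derivative_zero : (derivative (derivative p)).eval 0 ≠ 0
  eval_derivative_ne_zero : ∀ x ≠ 0, p.eval x = 0 → (derivative p).eval x ≠ 0

theorem HasOnlyDoubleRootZero.ne_zero {p : L[X]} (h : HasOnlyDoubleRootZero p) : p ≠ 0 := by
  rintro rfl
  simpa using h.eval_second_derivative_zero

theorem HasOnlyDoubleRootZero.card_erase_add_two [CharZero L] [IsAlgClosed L] [DecidableEq L]
    {p : L[X]} (h : HasOnlyDoubleRootZero p) :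
    (p.roots.toFinset.erase 0).card + 2 = p.natDegree := by
  have hp := h.ne_zero
  have hzero : p.rootMultiplicity 0 = 2 := by
    have hp' : derivative p ≠ 0 := fun hp' => h.eval_second_derivative_zero (by simp [hp'])
    rw [rootMultiplicity_eq_derivative_add_one hp h.eval_zero,
      rootMultiplicity_eq_derivative_add_one hp' h.eval_derivative_zero,
      rootMultiplicity_eq_zero h.eval_second_derivative_zero]
  have hmem : (0 : L) ∈ p.roots.toFinset := by
    rw [Multiset.mem_toFinset, mem_roots hp]
    exact h.eval_zero
  rw [(IsAlgClosed.splits p).natDegree_eq_card_roots, ← Multiset.toFinset_sum_count_eq p.roots,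
    ← Finset.sum_erase_add _ _ hmem, count_roots, hzero, Finset.card_eq_sum_ones]
  congr 1
  refine Finset.sum_congr rfl fun x hx => ?_
  rw [Finset.mem_erase, Multiset.mem_toFinset, mem_roots hp] at hx
  rw [count_roots, rootMultiplicity_eq_derivative_add_one hp hx.2,
    rootMultiplicity_eq_zero (h.eval_derivative_ne_zero x hx.1 hx.2)]

theorem exists_prod_X_sub_C_dvd {p : (PowerSeries L)[X]} {S : Finset L}
    (hroot : ∀ s ∈ S, (p.map PowerSeries.constantCoeff).eval s = 0)
    (hsimple : ∀ s ∈ S, (derivative (p.map PowerSeries.constantCoeff)).eval s ≠ 0) :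
    ∃ r : L → PowerSeries L, (∀ s ∈ S, PowerSeries.constantCoeff (r s) = s) ∧
      ∏ s ∈ S, (X - C (r s)) ∣ p := by
  have hlift (s) (hs : s ∈ S) := exists_powerSeries_root p (hroot s hs) (hsimple s hs)
  choose! r hr hrs using hlift
  refine ⟨r, hrs, Finset.prod_dvd_of_coprime (fun s hs s' hs' hne => ?_)
    fun s hs => dvd_iff_isRoot.2 (hr s hs)⟩
  refine isCoprime_X_sub_C_of_isUnit_sub ?_
  rw [PowerSeries.isUnit_iff_constantCoeff, map_sub, hrs s hs, hrs s' hs', isUnit_iff_ne_zero]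
  exact sub_ne_zero.2 hne

variable {p : (PowerSeries L)[X]} [CharZero L] [IsAlgClosed L] (hlead : IsUnit p.leadingCoeff)
  (hp : HasOnlyDoubleRootZero (p.map PowerSeries.constantCoeff))
  (hnoroot : ∀ r, PowerSeries.constantCoeff r = 0 → p.eval r ≠ 0)

include hlead hp hnoroot

theorem HasOnlyDoubleRootZero.exists_eq_prod_mul_quadratic :
    ∃ (S : Finset L) (r : L → PowerSeries L) (Q : (PowerSeries L)[X]), Set.InjOn r S ∧
      p = (∏ s ∈ S, (X - C (r s))) * Q ∧ Q.natDegree = 2 ∧ IsUnit Q.leadingCoeff ∧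
      ∀ x, Q.eval x ≠ 0 := by
  classical
  set p₀ := p.map PowerSeries.constantCoeff
  set S := p₀.roots.toFinset.erase 0
  have hmem (s : L) : s ∈ S ↔ s ≠ 0 ∧ p₀.eval s = 0 := by
    rw [Finset.mem_erase, Multiset.mem_toFinset, mem_roots hp.ne_zero, IsRoot]
  obtain ⟨r, hr, Q, hQ⟩ := exists_prod_X_sub_C_dvd (fun s hs => ((hmem s).1 hs).2)
    fun s hs => hp.eval_derivative_ne_zero s ((hmem s).1 hs).1 ((hmem s).1 hs).2
  have hmonic : (∏ s ∈ S, (X - C (r s))).Monic := monic_prod_X_sub_C _ _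
  have hleadQ : IsUnit Q.leadingCoeff := by
    rwa [hQ, leadingCoeff_mul, hmonic.leadingCoeff, one_mul] at hlead
  refine ⟨S, r, Q, fun s hs s' hs' h => by rw [← hr s hs, ← hr s' hs', h], hQ, ?_, hleadQ,
    fun x hx => ?_⟩
  · have hdeg := hp.card_erase_add_two
    rw [natDegree_map_of_leadingCoeff_ne_zero _ (hlead.map _).ne_zero, hQ,
      hmonic.natDegree_mul' (leadingCoeff_ne_zero.1 hleadQ.ne_zero),
      natDegree_finsetProd_X_sub_C_eq_card] at hdeg
    exact (Nat.add_left_cancel hdeg).symm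
  · have hpx : p.eval x = 0 := by rw [hQ, eval_mul, hx, mul_zero]
    have hx0 : PowerSeries.constantCoeff x ≠ 0 := fun h => hnoroot x h hpx
    have hp₀x : p₀.eval (PowerSeries.constantCoeff x) = 0 := by
      rw [eval_map_apply, hpx, map_zero]
    have hxS := (hmem _).2 ⟨hx0, hp₀x⟩
    refine hp.eval_derivative_ne_zero _ hx0 hp₀x ?_
    have hlin : ((∏ s ∈ S, (X - C (r s))).map PowerSeries.constantCoeff).eval
        (PowerSeries.constantCoeff x) = 0 := by
      rw [Polynomial.map_prod, eval_prod]
      exact Finset.prod_eq_zero hxS (by simp [hr _ hxS])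
    have hquad : (Q.map PowerSeries.constantCoeff).eval (PowerSeries.constantCoeff x) = 0 := by
      rw [eval_map_apply, hx, map_zero]
    have hp₀ : p₀ = (∏ s ∈ S, (X - C (r s))).map PowerSeries.constantCoeff *
        Q.map PowerSeries.constantCoeff := by
      rw [← Polynomial.map_mul, ← hQ]
    rw [hp₀, derivative_mul, eval_add, eval_mul, eval_mul, hlin, hquad, mul_zero, zero_mul,
      add_zero]

theorem HasOnlyDoubleRootZero.exists_algEquiv_swap {k E : Type*} [Field k] [CharZero k] [Field E]
    [IsAlgClosed E] [Algebra k E] [Normal k E] [Algebra (PowerSeries L) k]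
    [IsFractionRing (PowerSeries L) k] [Algebra (PowerSeries L) E]
    [IsScalarTower (PowerSeries L) k E] :
    (p.map (algebraMap (PowerSeries L) E)).Separable ∧
      ∃ (ρ₁ ρ₂ : E) (σ : E ≃ₐ[k] E), ρ₁ ≠ ρ₂ ∧ aeval ρ₁ p = 0 ∧ aeval ρ₂ p = 0 ∧
        σ ρ₁ = ρ₂ ∧ σ ρ₂ = ρ₁ ∧ ∀ z, aeval z p = 0 → z ≠ ρ₁ → z ≠ ρ₂ → σ z = z := by
  obtain ⟨S, r, Q, hr, hQ, hdeg, hleadQ, hroot⟩ :=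
    HasOnlyDoubleRootZero.exists_eq_prod_mul_quadratic hlead hp hnoroot
  set M : (PowerSeries L)[X] := ∏ s ∈ S, (X - C (r s))
  have hk : Function.Injective (algebraMap (PowerSeries L) k) := IsFractionRing.injective _ k
  have hM : M.map (algebraMap (PowerSeries L) k) = ∏ s ∈ S, (X - C (algebraMap _ k (r s))) := by
    simp [M, Polynomial.map_prod]
  have hirr : Irreducible (Q.map (algebraMap (PowerSeries L) k)) :=
    irreducible_map_of_natDegree_two hdeg hleadQ hroot
  have hcoprime : IsCoprime (M.map (algebraMap (PowerSeries L) k)) (Q.map (algebraMap _ k)) := by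
    rw [hM]
    refine IsCoprime.prod_left fun s _ => ?_
    refine ((irreducible_X_sub_C _).coprime_iff_not_dvd).2 fun hdvd => hroot (r s) (hk ?_)
    rw [← eval_map_apply, map_zero]
    exact dvd_iff_isRoot.1 hdvd
  have hsepM : (M.map (algebraMap (PowerSeries L) k)).Separable :=
    hM ▸ separable_prod_X_sub_C_iff'.2 fun s hs s' hs' h => hr hs hs' (hk h)
  obtain ⟨ρ₁, ρ₂, σ, hne, hρ, hσ₁, hσ₂⟩ := exists_algEquiv_swap_of_natDegree_two (E := E) hirr
    ((natDegree_map_eq_of_injective hk Q).trans hdeg)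
  simp only [aeval_map_algebraMap] at hρ
  have hroots (z : E) : aeval z p = 0 ↔ aeval z M = 0 ∨ z = ρ₁ ∨ z = ρ₂ := by
    rw [hQ, map_mul, mul_eq_zero, hρ]
  refine ⟨?_, ρ₁, ρ₂, σ, hne, (hroots _).2 (Or.inr (Or.inl rfl)),
    (hroots _).2 (Or.inr (Or.inr rfl)), hσ₁, hσ₂, fun z hz hz₁ hz₂ => ?_⟩
  · rw [IsScalarTower.algebraMap_eq (PowerSeries L) k E, ← Polynomial.map_map, hQ,
      Polynomial.map_mul]
    exact (hsepM.mul hirr.separable hcoprime).map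
  · have hzM := ((hroots z).1 hz).resolve_right (not_or.2 ⟨hz₁, hz₂⟩)
    simp only [M, map_prod, map_sub, aeval_X, aeval_C, Finset.prod_eq_zero_iff, sub_eq_zero] at hzM
    obtain ⟨s, -, rfl⟩ := hzM
    rw [IsScalarTower.algebraMap_apply (PowerSeries L) k E, σ.commutes]

end DoubleRoot

section Deformation

variable {L : Type*} [Field L]

/-- The deformation `p + u` of a polynomial `p` over the power series ring in `u`. -/
def deform (p : L[X]) : (PowerSeries L)[X] :=
  p.map PowerSeries.C + C PowerSeries.X

theorem derivative_deform (p : L[X]) :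
    derivative (deform p) = (derivative p).map PowerSeries.C := by
  rw [deform, derivative_add, derivative_C, add_zero, derivative_map]

theorem map_constantCoeff_deform (p : L[X]) :
    (deform p).map PowerSeries.constantCoeff = p := by
  have hC : (PowerSeries.constantCoeff (R := L)).comp PowerSeries.C = RingHom.id L := by
    ext x
    simp
  rw [deform, Polynomial.map_add, Polynomial.map_map, hC, Polynomial.map_id, map_C,
    PowerSeries.constantCoeff_X, C_0, add_zero]

theorem natDegree_deform (p : L[X]) : (deform p).natDegree = p.natDegree := by
  rw [deform, natDegree_add_C, natDegree_map_eq_of_injective PowerSeries.C_injective]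

theorem monic_deform {p : L[X]} (hp : p.Monic) (hd : p.natDegree ≠ 0) : (deform p).Monic := by
  refine (hp.map _).add_of_left (degree_C_le.trans_lt ?_)
  rw [← natDegree_pos_iff_degree_pos, hp.natDegree_map]
  exact Nat.pos_of_ne_zero hd

/-- The derivative at `u = 0` of the `m`-th iterate of `p + u` at `0`. -/
def orbitDeriv (p : L[X]) : ℕ → L
  | 0 => 0
  | m + 1 => (derivative p).eval ((fun y => p.eval y)^[m] 0) * orbitDeriv p m + 1

theorem exists_eval_map_C_add_eq (p : L[X]) (b : L) (h : PowerSeries L) : ∃ s : PowerSeries L,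
    (p.map PowerSeries.C).eval (PowerSeries.C b + h) = PowerSeries.C (p.eval b) +
      PowerSeries.C ((derivative p).eval b) * h + s * h ^ 2 := by
  obtain ⟨s, hs⟩ := (p.map PowerSeries.C).binomExpansion (PowerSeries.C b) h
  refine ⟨s, ?_⟩
  rw [hs, eval_map_apply, derivative_map, eval_map_apply]

theorem exists_iterate_deform_eq {p : L[X]} (hp : (derivative p).eval 0 = 0) {x : PowerSeries L}
    (hx : PowerSeries.constantCoeff x = 0) (m : ℕ) : ∃ r : PowerSeries L,
    (fun y => (deform p).eval y)^[m + 1] x = PowerSeries.C ((fun y => p.eval y)^[m + 1] 0) +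
      PowerSeries.C (orbitDeriv p (m + 1)) * PowerSeries.X + PowerSeries.X ^ 2 * r := by
  induction m with
  | zero =>
    obtain ⟨y, rfl⟩ := PowerSeries.X_dvd_iff.2 hx
    obtain ⟨s, hs⟩ := exists_eval_map_C_add_eq p 0 (PowerSeries.X * y)
    rw [map_zero, zero_add, hp, map_zero] at hs
    refine ⟨s * y ^ 2, ?_⟩
    simp only [zero_add, Function.iterate_one, orbitDeriv, mul_zero, map_one, deform, eval_add,
      eval_C, hs]
    ring
  | succ m ih =>
    obtain ⟨r, hr⟩ := ih
    set b := (fun y => p.eval y)^[m + 1] 0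
    set D := orbitDeriv p (m + 1)
    have hD : orbitDeriv p (m + 1 + 1) = (derivative p).eval b * D + 1 := rfl
    obtain ⟨s, hs⟩ := exists_eval_map_C_add_eq p b
      (PowerSeries.C D * PowerSeries.X + PowerSeries.X ^ 2 * r)
    rw [Function.iterate_succ_apply', hr, add_assoc, deform, eval_add, eval_C, hs,
      Function.iterate_succ_apply' _ (m + 1), hD, map_add, map_mul, map_one]
    refine ⟨PowerSeries.C ((derivative p).eval b) * r +
      s * (PowerSeries.C D + PowerSeries.X * r) ^ 2, ?_⟩
    ring

theorem eval_critIter_deform_ne_zero {p : L[X]} (hp : (derivative p).eval 0 = 0)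
    (hp' : (derivative (derivative p)).eval 0 ≠ 0) {n : ℕ}
    (hn : (fun y => p.eval y)^[n + 1] 0 = 0) (hD : orbitDeriv p (n + 1) ≠ 0) {x : PowerSeries L}
    (hx : PowerSeries.constantCoeff x = 0) : (critIter (deform p) (n + 1)).eval x ≠ 0 := by
  obtain ⟨r, hr⟩ := exists_iterate_deform_eq hp hx n
  set D := orbitDeriv p (n + 1)
  obtain ⟨s, hs⟩ := exists_eval_map_C_add_eq (derivative p) 0
    (PowerSeries.X * (PowerSeries.C D + PowerSeries.X * r))
  rw [hp, map_zero, zero_add, zero_add] at hs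
  rw [eval_critIter, derivative_deform, hr, hn, map_zero, zero_add,
    show PowerSeries.C D * PowerSeries.X + PowerSeries.X ^ 2 * r =
      PowerSeries.X * (PowerSeries.C D + PowerSeries.X * r) by ring, hs,
    show ∀ c y : PowerSeries L, c * (PowerSeries.X * y) + s * (PowerSeries.X * y) ^ 2 =
      PowerSeries.X * (c * y + PowerSeries.X * (s * y ^ 2)) by intros; ring]
  refine mul_ne_zero PowerSeries.X_ne_zero fun h => mul_ne_zero hp' hD ?_
  simpa using congrArg PowerSeries.constantCoeff h

end Deformation

section SwapCriterion

/-- The critical point `0` of `p` has exact period `n + 1`, the period relation is transverse to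
the family `p + u`, all critical points are simple, and those other than `0` are not eventually
mapped to critical points. -/
structure IsTransversePeriodic {L : Type*} [Field L] (p : L[X]) (n : ℕ) : Prop where
  critical : (derivative p).eval 0 = 0
  simple : ∀ c, (derivative p).eval c = 0 → (derivative (derivative p)).eval c ≠ 0
  escape : ∀ c ≠ 0, (derivative p).eval c = 0 →
    ∀ m, (derivative p).eval ((fun y => p.eval y)^[m + 1] c) ≠ 0
  not_critical : ∀ m < n, (derivative p).eval ((fun y => p.eval y)^[m + 1] 0) ≠ 0
  periodic : (fun y => p.eval y)^[n + 1] 0 = 0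
  transverse : orbitDeriv p (n + 1) ≠ 0

theorem IsTransversePeriodic.hasOnlyDoubleRootZero_critIter {L : Type*} [Field L] {p : L[X]}
    {n : ℕ} (h : IsTransversePeriodic p n) : HasOnlyDoubleRootZero (critIter p (n + 1)) where
  eval_zero := by rw [eval_critIter, h.periodic, h.critical]
  eval_derivative_zero := by
    rw [eval_derivative_critIter, Finset.prod_eq_zero (Finset.mem_range.2 n.succ_pos), zero_mul]
    rw [eval_critIter, Function.iterate_zero_apply, h.critical]
  eval_second_derivative_zero := by
    have hfactor : derivative (critIter p (n + 1)) = derivative p *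
        ((∏ k ∈ Finset.range n, critIter p (k + 1)) *
          (derivative (derivative p)).comp (p.comp^[n + 1] X)) := by
      rw [critIter, derivative_comp, derivative_iterate_comp_X, Finset.prod_range_succ',
        show critIter p 0 = derivative p from comp_X]
      ring
    rw [hfactor, derivative_mul, eval_add, eval_mul, eval_mul (p := derivative p), h.critical,
      zero_mul, add_zero, eval_mul, eval_prod, eval_comp, iterate_comp_eval, eval_X, h.periodic]
    refine mul_ne_zero (h.simple 0 h.critical) (mul_ne_zero
      (Finset.prod_ne_zero_iff.2 fun k hk => ?_) (h.simple 0 h.critical))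
    rw [eval_critIter]
    exact h.not_critical k (Finset.mem_range.1 hk)
  eval_derivative_ne_zero x hx hx0 := by
    rw [eval_critIter] at hx0
    rw [eval_derivative_critIter]
    refine mul_ne_zero (Finset.prod_ne_zero_iff.2 fun k hk hk0 => ?_) (h.simple _ hx0)
    rw [eval_critIter] at hk0
    have hkn := Finset.mem_range.1 hk
    obtain ⟨m, hm⟩ : ∃ m, n + 1 = m + 1 + k := ⟨n - k, by omega⟩
    rw [hm, Function.iterate_add_apply] at hx0
    by_cases hc : (fun y => p.eval y)^[k] x = 0
    · have hk : k ≠ 0 := by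
        rintro rfl
        exact hx hc
      rw [hc] at hx0
      exact h.not_critical m (by omega) hx0
    · exact h.escape _ hc hk0 m hx0

variable {K E : Type*} [Field K] [CharZero K] [Field E] [Algebra K E] {d : ℕ}

open scoped Classical in
theorem exists_gal_isSwap_of_algHom [NeZero d] [IsAlgClosed E] {p : E[X]} (hp : p.Monic)
    (hpd : p.natDegree = d) {n : ℕ} (hsep : (critIter p n).Separable) {ρ₁ ρ₂ : E} (hne : ρ₁ ≠ ρ₂)
    (h₁ : (critIter p n).eval ρ₁ = 0) (h₂ : (critIter p n).eval ρ₂ = 0) (σ : E →ₐ[K] E)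
    (hσ : p.map σ = p) (hσ₁ : σ ρ₁ = ρ₂) (hσ₂ : σ ρ₂ = ρ₁)
    (hσ' : ∀ z, (critIter p n).eval z = 0 → z ≠ ρ₁ → z ≠ ρ₂ → σ z = z) :
    ∃ g : Gal(GenericClosure K d/GenericField K d),
      (MulAction.toPerm g : Equiv.Perm (GenericVertex K d n)).IsSwap := by
  obtain ⟨ψ, hψ⟩ := exists_isSpecialization (K := K) hp hpd
  have hinj := hψ.vertex_injective hsep
  obtain ⟨a, rfl⟩ := hψ.exists_vertex_eq hsep.ne_zero h₁
  obtain ⟨b, rfl⟩ := hψ.exists_vertex_eq hsep.ne_zero h₂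
  obtain ⟨g, hg⟩ := hψ.exists_gal_lifting_algHom σ hσ n
  refine ⟨g, a, b, fun hab => hne (by rw [hab]), Equiv.ext fun x => hinj ?_⟩
  change ψ (vertexInteger (g • x)) = _
  rw [hg, Equiv.swap_apply_def]
  split_ifs with hxa hxb
  · rw [hxa, hσ₁]
  · rw [hxb, hσ₂]
  · exact hσ' _ (hψ.eval_vertex x) (hinj.ne hxa) (hinj.ne hxb)

variable {L : Type*} [Field L] [Algebra K L] [CharZero L] [IsAlgClosed L] {p : L[X]} {n : ℕ}

variable (K) in
open scoped Classical in
theorem IsTransversePeriodic.exists_gal_isSwap [NeZero d] (h : IsTransversePeriodic p n)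
    (hp : p.Monic) (hpd : p.natDegree = d) : ∃ g : Gal(GenericClosure K d/GenericField K d),
      (MulAction.toPerm g : Equiv.Perm (GenericVertex K d (n + 1))).IsSwap := by
  let k := FractionRing (PowerSeries L)
  let E := AlgebraicClosure k
  have : CharZero (PowerSeries L) := charZero_of_injective_algebraMap PowerSeries.C_injective
  have : CharZero k := charZero_of_injective_algebraMap (IsFractionRing.injective (PowerSeries L) k)
  have hpd0 : p.natDegree ≠ 0 := hpd ▸ NeZero.ne d
  have hmonic := monic_deform hp hpd0
  have hlead : IsUnit (critIter (deform p) (n + 1)).leadingCoeff := by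
    rw [leadingCoeff_critIter hmonic (by rwa [natDegree_deform]), natDegree_deform,
      PowerSeries.isUnit_iff_constantCoeff, map_natCast, isUnit_iff_ne_zero]
    exact Nat.cast_ne_zero.2 hpd0
  have hdouble : HasOnlyDoubleRootZero
      ((critIter (deform p) (n + 1)).map PowerSeries.constantCoeff) := by
    rw [map_critIter, map_constantCoeff_deform]
    exact h.hasOnlyDoubleRootZero_critIter
  obtain ⟨hsep, ρ₁, ρ₂, σ, hne, h₁, h₂, hσ₁, hσ₂, hσ⟩ :=
    HasOnlyDoubleRootZero.exists_algEquiv_swap hlead hdouble (k := k) (E := E) fun r hr =>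
      eval_critIter_deform_ne_zero h.critical (h.simple 0 h.critical) h.periodic h.transverse hr
  rw [map_critIter] at hsep
  simp only [← eval_map_algebraMap, map_critIter] at h₁ h₂ hσ
  refine exists_gal_isSwap_of_algHom (hmonic.map _) (by rw [hmonic.natDegree_map, natDegree_deform,
    hpd]) hsep hne h₁ h₂ (σ.toAlgHom.restrictScalars K) ?_ hσ₁ hσ₂ hσ
  rw [Polynomial.map_map]
  congr 1
  ext x
  exact σ.commutes _

end SwapCriterion

section Gleason

/-- The iterates of `0` under `x ^ 2 + T`, as polynomials in the parameter `T`. -/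
def gleason (R : Type*) [CommRing R] : ℕ → R[X]
  | 0 => 0
  | m + 1 => gleason R m ^ 2 + X

theorem map_gleason {R S : Type*} [CommRing R] [CommRing S] (φ : R →+* S) (m : ℕ) :
    (gleason R m).map φ = gleason S m := by
  induction m with
  | zero => exact Polynomial.map_zero φ
  | succ m ih => rw [gleason, gleason, Polynomial.map_add, Polynomial.map_pow, ih, map_X]

theorem monic_gleason_and_natDegree_gleason (R : Type*) [CommRing R] [Nontrivial R] (m : ℕ) :
    (gleason R (m + 1)).Monic ∧ (gleason R (m + 1)).natDegree = 2 ^ m := by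
  induction m with
  | zero => simp [gleason, monic_X]
  | succ m ih =>
    have hsq : (gleason R (m + 1) ^ 2).natDegree = 2 ^ (m + 1) := by
      rw [ih.1.natDegree_pow, ih.2, pow_succ']
    have hlt : (X : R[X]).natDegree < (gleason R (m + 1) ^ 2).natDegree := by
      rw [hsq, natDegree_X]
      exact Nat.one_lt_two_pow m.succ_ne_zero
    exact ⟨(ih.1.pow 2).add_of_left (degree_lt_degree hlt),
      (natDegree_add_eq_left_of_natDegree_lt hlt).trans hsq⟩

theorem monic_gleason (R : Type*) [CommRing R] [Nontrivial R] (m : ℕ) :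
    (gleason R (m + 1)).Monic :=
  (monic_gleason_and_natDegree_gleason R m).1

theorem natDegree_gleason (R : Type*) [CommRing R] [Nontrivial R] (m : ℕ) :
    (gleason R (m + 1)).natDegree = 2 ^ m :=
  (monic_gleason_and_natDegree_gleason R m).2

theorem derivative_gleason (R : Type*) [CommRing R] (m : ℕ) :
    derivative (gleason R (m + 1)) = 2 * (gleason R m * derivative (gleason R m)) + 1 := by
  rw [gleason, derivative_add, derivative_sq, derivative_X, C_ofNat, mul_assoc]

variable {L : Type*} [Field L]

theorem derivative_X_sq_add_C (t : L) : derivative (X ^ 2 + C t : L[X]) = C 2 * X := by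
  rw [derivative_add, derivative_C, derivative_X_sq, add_zero]

theorem iterate_X_sq_add_C_zero (t : L) (m : ℕ) :
    (fun y => (X ^ 2 + C t : L[X]).eval y)^[m] 0 = (gleason L m).eval t := by
  induction m with
  | zero => rw [Function.iterate_zero_apply, gleason, eval_zero]
  | succ m ih =>
    rw [Function.iterate_succ_apply', ih, gleason]
    simp only [eval_add, eval_pow, eval_X, eval_C]

theorem orbitDeriv_X_sq_add_C (t : L) (m : ℕ) :
    orbitDeriv (X ^ 2 + C t) m = (derivative (gleason L m)).eval t := by
  induction m with
  | zero => rw [orbitDeriv, gleason, derivative_zero, eval_zero]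
  | succ m ih =>
    rw [orbitDeriv, iterate_X_sq_add_C_zero, ih, derivative_gleason, derivative_X_sq_add_C]
    simp only [eval_mul, eval_X, eval_C, eval_add, eval_one, eval_ofNat, mul_assoc]

variable [CharZero L]

theorem two_mul_ne_neg_one_of_isIntegral {a : L} (ha : IsIntegral ℤ a) : 2 * a ≠ -1 := by
  intro h
  have ha' : algebraMap ℚ L (-1 / 2) = a := by
    rw [map_div₀, map_neg, map_one, map_ofNat, ← h, mul_div_cancel_left₀ a two_ne_zero]
  rw [← ha', isIntegral_algebraMap_iff (algebraMap ℚ L).injective] at ha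
  obtain ⟨z, hz⟩ := IsIntegrallyClosed.isIntegral_iff.1 ha
  have hz' : (2 * z : ℚ) = -1 := by
    rw [← eq_intCast (algebraMap ℤ ℚ), hz]
    norm_num
  have : 2 * z = -1 := by exact_mod_cast hz'
  omega

-- The root `t` is an algebraic integer and the derivative at `t` is congruent to `1` modulo `2`.
theorem eval_derivative_gleason_ne_zero {m : ℕ} {t : L} (ht : (gleason L (m + 1)).eval t = 0) :
    (derivative (gleason L (m + 1))).eval t ≠ 0 := by
  have ht' : IsIntegral ℤ t :=
    ⟨gleason ℤ (m + 1), monic_gleason ℤ m, by rw [← eval_map, map_gleason, ht]⟩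
  have hint : IsIntegral ℤ ((gleason L m * derivative (gleason L m)).eval t) := by
    rw [← map_gleason (algebraMap ℤ L), derivative_map, ← Polynomial.map_mul, eval_map_algebraMap]
    exact adjoin_le_integralClosure ht' (aeval_mem_adjoin_singleton ℤ t)
  rw [derivative_gleason, eval_add, eval_mul, eval_ofNat, eval_one]
  exact fun h => two_mul_ne_neg_one_of_isIntegral hint (eq_neg_of_add_eq_zero_left h)

theorem nodup_roots_gleason (m : ℕ) : (gleason L (m + 1)).roots.Nodup := by
  classical
  refine Multiset.nodup_iff_count_le_one.2 fun t => ?_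
  rw [count_roots, ← not_lt, one_lt_rootMultiplicity_iff_isRoot (monic_gleason L m).ne_zero]
  exact fun h => eval_derivative_gleason_ne_zero h.1 h.2

-- The polynomials `gleason L (m + 1)` with `m < n` have fewer than `2 ^ n` roots in total.
theorem exists_gleason_root [IsAlgClosed L] (n : ℕ) : ∃ t : L, (gleason L (n + 1)).eval t = 0 ∧
    ∀ m < n, (gleason L (m + 1)).eval t ≠ 0 := by
  by_contra! hcon
  set Q : L[X] := ∏ m ∈ Finset.range n, gleason L (m + 1)
  have hQ : Q.Monic := monic_prod_of_monic _ _ fun m _ => monic_gleason L m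
  have hQd : Q.natDegree < 2 ^ n := by
    rw [natDegree_prod_of_monic _ _ fun m _ => monic_gleason L m,
      Finset.sum_congr rfl fun m _ => natDegree_gleason L m]
    exact Nat.geomSum_lt le_rfl fun m hm => Finset.mem_range.1 hm
  have hsub : (gleason L (n + 1)).roots ≤ Q.roots := by
    refine (Multiset.le_iff_subset (nodup_roots_gleason n)).2 fun t ht => ?_
    obtain ⟨m, hm, hm0⟩ := hcon t (isRoot_of_mem_roots ht)
    rw [mem_roots hQ.ne_zero, IsRoot, eval_prod]
    exact Finset.prod_eq_zero (Finset.mem_range.2 hm) hm0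
  refine hQd.not_ge ?_
  calc 2 ^ n = (gleason L (n + 1)).roots.card := by
        rw [← (IsAlgClosed.splits _).natDegree_eq_card_roots, natDegree_gleason]
    _ ≤ Q.roots.card := Multiset.card_le_card hsub
    _ ≤ Q.natDegree := card_roots' Q

theorem exists_isTransversePeriodic_quadratic [IsAlgClosed L] (n : ℕ) :
    ∃ p : L[X], p.Monic ∧ p.natDegree = 2 ∧ IsTransversePeriodic p n := by
  obtain ⟨t, ht, htn⟩ := exists_gleason_root (L := L) n
  have hcrit (x : L) : (derivative (X ^ 2 + C t : L[X])).eval x = 0 ↔ x = 0 := by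
    rw [derivative_X_sq_add_C, eval_mul, eval_C, eval_X, mul_eq_zero, or_iff_right two_ne_zero]
  refine ⟨X ^ 2 + C t, monic_X_pow_add_C t two_ne_zero, natDegree_X_pow_add_C,
    { critical := (hcrit 0).2 rfl
      simple := fun c _ => ?_
      escape := fun c hc0 hc => absurd ((hcrit c).1 hc) hc0
      not_critical := fun m hm => ?_
      periodic := by rw [iterate_X_sq_add_C_zero, ht]
      transverse := by
        rw [orbitDeriv_X_sq_add_C]
        exact eval_derivative_gleason_ne_zero ht }⟩
  · rw [derivative_X_sq_add_C, derivative_C_mul, derivative_X, mul_one, eval_C]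
    exact two_ne_zero
  · rw [Ne, hcrit, iterate_X_sq_add_C_zero]
    exact htn m hm

end Gleason

section Escape

/-- The polynomial `x ^ (e + 2) + ε ^ (-e) * x ^ 2 + ε ^ e * t`, for small `ε`. Scaled by `ε ^ e` it
is a small perturbation of `x ^ 2 + t`, and its critical points other than `0`, which have size
`ε ^ (-1)`, escape to infinity. -/
def escapePoly {L : Type*} [Field L] (e : ℕ) (ε t : L) : L[X] :=
  X ^ (e + 2) + C (ε ^ e)⁻¹ * X ^ 2 + C (ε ^ e * t)

/-- The iterates of `0` under `x ^ 2 + ε ^ (e * (e + 1)) * x ^ (e + 2) + T`, as polynomials in the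
parameter `T`. This is the map to which the substitution `ε ^ e * x` conjugates `escapePoly`. -/
def gleasonDeform (L₀ : Type*) [Field L₀] (e : ℕ) : ℕ → (PowerSeries L₀)[X]
  | 0 => 0
  | m + 1 => gleasonDeform L₀ e m ^ 2 +
      C (PowerSeries.X ^ (e * (e + 1))) * gleasonDeform L₀ e m ^ (e + 2) + X

theorem map_constantCoeff_gleasonDeform {L₀ : Type*} [Field L₀] {e : ℕ} (he : e ≠ 0) (m : ℕ) :
    (gleasonDeform L₀ e m).map PowerSeries.constantCoeff = gleason L₀ m := by
  induction m with
  | zero => exact Polynomial.map_zero _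
  | succ m ih => simp [gleason, gleasonDeform, ih, he]

theorem constantCoeff_eval_gleasonDeform {L₀ : Type*} [Field L₀] {e : ℕ} (he : e ≠ 0) (m : ℕ)
    (t : PowerSeries L₀) : PowerSeries.constantCoeff ((gleasonDeform L₀ e m).eval t) =
      (gleason L₀ m).eval (PowerSeries.constantCoeff t) := by
  rw [← eval_map_apply, map_constantCoeff_gleasonDeform he]

section

variable {L : Type*} [Field L] {e : ℕ} (ε t : L)

theorem monic_escapePoly (he : e ≠ 0) : (escapePoly e ε t).Monic := by
  rw [escapePoly, add_assoc]
  refine monic_X_pow_add (lt_of_le_of_lt (b := (2 : WithBot ℕ)) ?_ (by exact_mod_cast by omega))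
  compute_degree

theorem natDegree_escapePoly (he : e ≠ 0) : (escapePoly e ε t).natDegree = e + 2 := by
  rw [escapePoly, add_assoc, natDegree_add_eq_left_of_natDegree_lt, natDegree_X_pow]
  rw [natDegree_X_pow]
  refine lt_of_le_of_lt (b := 2) ?_ (by omega)
  compute_degree

theorem eval_escapePoly (x : L) : (escapePoly e ε t).eval x =
    x ^ (e + 2) + (ε ^ e)⁻¹ * x ^ 2 + ε ^ e * t := by
  simp only [escapePoly, eval_add, eval_mul, eval_pow, eval_X, eval_C]

theorem derivative_escapePoly : derivative (escapePoly e ε t) =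
    C ((e : L) + 2) * X ^ (e + 1) + C (2 * (ε ^ e)⁻¹) * X := by
  simp only [escapePoly, derivative_add, derivative_C, derivative_X_pow, derivative_C_mul,
    Nat.add_one_sub_one, Nat.cast_add, Nat.cast_ofNat, map_mul, pow_one]
  ring

theorem eval_derivative_escapePoly (x : L) : (derivative (escapePoly e ε t)).eval x =
    x * (((e : L) + 2) * x ^ e + 2 * (ε ^ e)⁻¹) := by
  simp only [derivative_escapePoly, eval_add, eval_mul, eval_pow, eval_X, eval_C]
  ring

theorem eval_second_derivative_escapePoly (x : L) :
    (derivative (derivative (escapePoly e ε t))).eval x =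
      ((e : L) + 2) * (e + 1) * x ^ e + 2 * (ε ^ e)⁻¹ := by
  simp only [derivative_escapePoly, derivative_add, derivative_C_mul, derivative_X_pow,
    derivative_X, Nat.add_one_sub_one, eval_add, eval_mul, eval_pow, eval_X, eval_C, eval_one,
    Nat.cast_add, Nat.cast_one]
  ring

variable {ε t}

theorem eval_second_derivative_escapePoly_ne_zero [CharZero L] (he : e ≠ 0) (hε : ε ≠ 0) {c : L}
    (hc : (derivative (escapePoly e ε t)).eval c = 0) :
    (derivative (derivative (escapePoly e ε t))).eval c ≠ 0 := by
  rw [eval_second_derivative_escapePoly]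
  rw [eval_derivative_escapePoly] at hc
  rcases mul_eq_zero.1 hc with rfl | hc
  · simp [he, hε]
  · rw [show ((e : L) + 2) * (e + 1) * c ^ e + 2 * (ε ^ e)⁻¹ = -(2 * e * (ε ^ e)⁻¹) by
      linear_combination ((e : L) + 1) * hc]
    simp [he, hε]

theorem add_two_mul_pow_eq_of_critical (hε : ε ≠ 0) {c : L} (hc0 : c ≠ 0)
    (hc : (derivative (escapePoly e ε t)).eval c = 0) : ((e : L) + 2) * (c * ε) ^ e = -2 := by
  rw [eval_derivative_escapePoly, mul_eq_zero, or_iff_right hc0] at hc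
  field_simp at hc
  linear_combination hc

end

variable {L₀ L : Type*} [Field L₀] [Field L] {j : PowerSeries L₀ →+* L}
  (hj : Function.Injective j) {e : ℕ} (t : PowerSeries L₀)

include hj

theorem map_X_ne_zero_of_injective : j PowerSeries.X ≠ 0 :=
  (map_ne_zero_iff j hj).2 PowerSeries.X_ne_zero

theorem iterate_escapePoly_zero (m : ℕ) :
    (fun y => (escapePoly e (j PowerSeries.X) (j t)).eval y)^[m] 0 =
      j PowerSeries.X ^ e * j ((gleasonDeform L₀ e m).eval t) := by
  have := map_X_ne_zero_of_injective hj
  induction m with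
  | zero => rw [Function.iterate_zero_apply, gleasonDeform, eval_zero, map_zero, mul_zero]
  | succ m ih =>
    rw [Function.iterate_succ_apply', ih, eval_escapePoly, gleasonDeform]
    simp only [eval_add, eval_mul, eval_pow, eval_C, eval_X, map_add, map_mul, map_pow]
    field_simp
    ring

theorem exists_eval_derivative_escapePoly_eq (he : e ≠ 0) (z : PowerSeries L₀) :
    ∃ y : PowerSeries L₀, PowerSeries.constantCoeff y = 2 * PowerSeries.constantCoeff z ∧
      (derivative (escapePoly e (j PowerSeries.X) (j t))).eval (j PowerSeries.X ^ e * j z) =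
        j y := by
  have hε := map_X_ne_zero_of_injective hj
  refine ⟨z * (((e : PowerSeries L₀) + 2) * PowerSeries.X ^ (e * (e + 1)) * z ^ e + 2), ?_, ?_⟩
  · simp [he, map_ofNat PowerSeries.constantCoeff, mul_comm]
  · rw [eval_derivative_escapePoly]
    simp only [map_add, map_mul, map_pow, map_natCast, map_ofNat]
    field_simp
    ring

theorem eval_derivative_iterate_escapePoly_zero_ne_zero [CharZero L₀] (he : e ≠ 0) {m : ℕ}
    (hm : (gleason L₀ m).eval (PowerSeries.constantCoeff t) ≠ 0) :
    (derivative (escapePoly e (j PowerSeries.X) (j t))).eval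
      ((fun y => (escapePoly e (j PowerSeries.X) (j t)).eval y)^[m] 0) ≠ 0 := by
  obtain ⟨y, hy0, hy⟩ :=
    exists_eval_derivative_escapePoly_eq hj t he ((gleasonDeform L₀ e m).eval t)
  rw [iterate_escapePoly_zero hj, hy, map_ne_zero_iff j hj]
  rintro rfl
  rw [map_zero, constantCoeff_eval_gleasonDeform he] at hy0
  exact mul_ne_zero two_ne_zero hm hy0.symm

theorem exists_orbitDeriv_escapePoly (he : e ≠ 0) (m : ℕ) : ∃ D : PowerSeries L₀,
    orbitDeriv (escapePoly e (j PowerSeries.X) (j t)) m = j D ∧ PowerSeries.constantCoeff D =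
      (derivative (gleason L₀ m)).eval (PowerSeries.constantCoeff t) := by
  induction m with
  | zero => exact ⟨0, by simp [orbitDeriv, gleason]⟩
  | succ m ih =>
    obtain ⟨D, hD, hD0⟩ := ih
    obtain ⟨y, hy0, hy⟩ :=
      exists_eval_derivative_escapePoly_eq hj t he ((gleasonDeform L₀ e m).eval t)
    refine ⟨y * D + 1, ?_, ?_⟩
    · rw [orbitDeriv, iterate_escapePoly_zero hj, hy, hD, map_add, map_mul, map_one]
    · rw [map_add, map_mul, map_one, hy0, hD0, constantCoeff_eval_gleasonDeform he,
        derivative_gleason, eval_add, eval_mul, eval_mul, eval_one, eval_ofNat, mul_assoc]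

variable {t}

theorem exists_mul_eq_of_critical [CharZero L₀] [IsAlgClosed L₀] {c : L} (hc0 : c ≠ 0)
    (hc : (derivative (escapePoly e (j PowerSeries.X) (j t))).eval c = 0) :
    ∃ γ : L₀, ((e : L₀) + 2) * γ ^ e = -2 ∧ c * j PowerSeries.X = j (PowerSeries.C γ) := by
  set i : L₀ →+* L := j.comp PowerSeries.C
  have hcrit := add_two_mul_pow_eq_of_critical (map_X_ne_zero_of_injective hj) hc0 hc
  set q : L₀[X] := C ((e : L₀) + 2) * X ^ e + C 2
  have heval (γ : L₀) : q.eval γ = ((e : L₀) + 2) * γ ^ e + 2 := by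
    simp only [q, eval_add, eval_mul, eval_pow, eval_X, eval_C]
  have hq : q ≠ 0 := by
    intro h
    have h1 := heval 1
    rw [h, eval_zero, one_pow, mul_one] at h1
    exact (e + 3).cast_add_one_ne_zero (R := L₀) (by push_cast; linear_combination -h1)
  have hroot : (q.map i).IsRoot (c * j PowerSeries.X) := by
    simp only [q, IsRoot, Polynomial.map_add, Polynomial.map_mul, Polynomial.map_pow, map_X, map_C,
      eval_add, eval_mul, eval_pow, eval_X, eval_C]
    rw [map_add, map_natCast, map_ofNat, hcrit, neg_add_cancel]
  obtain ⟨γ, hγ⟩ := (IsAlgClosed.splits q).mem_range_of_isRoot hq hroot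
  rw [← hγ, IsRoot, eval_map_apply, map_eq_zero, heval] at hroot
  exact ⟨γ, eq_neg_of_add_eq_zero_left hroot, hγ.symm⟩

theorem eval_escapePoly_mul_pow {x : L} {s : ℕ} {y : PowerSeries L₀}
    (hy : x * j PowerSeries.X ^ (s + 1) = j y) :
    (escapePoly e (j PowerSeries.X) (j t)).eval x * j PowerSeries.X ^ ((s + 1) * (e + 2)) =
      j (y ^ (e + 2) + PowerSeries.X ^ (s * e) * y ^ 2 +
        PowerSeries.X ^ (e + (s + 1) * (e + 2)) * t) := by
  have hε := map_X_ne_zero_of_injective hj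
  simp only [eval_escapePoly, map_add, map_mul, map_pow, ← hy]
  field_simp
  ring

theorem exists_iterate_escapePoly_critical [CharZero L₀] [IsAlgClosed L₀] (he : e ≠ 0) {c : L}
    (hc0 : c ≠ 0) (hc : (derivative (escapePoly e (j PowerSeries.X) (j t))).eval c = 0) (m : ℕ) :
    ∃ (s : ℕ) (y : PowerSeries L₀), PowerSeries.constantCoeff y ≠ 0 ∧
      (fun y => (escapePoly e (j PowerSeries.X) (j t)).eval y)^[m + 1] c *
        j PowerSeries.X ^ (s + 2) = j y := by
  induction m with
  | zero =>
    obtain ⟨γ, hγ, hcγ⟩ := exists_mul_eq_of_critical hj hc0 hc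
    have hstep := eval_escapePoly_mul_pow (e := e) (t := t) hj (s := 0)
      (by rw [zero_add, pow_one, hcγ])
    rw [zero_add, one_mul] at hstep
    refine ⟨e, _, ?_, hstep⟩
    have hγ0 : γ ≠ 0 := by
      rintro rfl
      simp [he] at hγ
    have hγ1 : γ ^ e + 1 ≠ 0 := by
      intro h
      have he0 : (e : L₀) = 0 := by linear_combination (e + 2) * h - hγ
      exact he (Nat.cast_eq_zero.1 he0)
    have hfactor : γ ^ (e + 2) + γ ^ 2 = γ ^ 2 * (γ ^ e + 1) := by ring
    simpa [hfactor, hγ0] using hγ1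
  | succ m ih =>
    obtain ⟨s, y, hy0, hy⟩ := ih
    have hstep := eval_escapePoly_mul_pow (e := e) (t := t) hj hy
    rw [show (s + 1 + 1) * (e + 2) = (s + 2) * e + 2 * (s + 1) + 2 by ring,
      ← Function.iterate_succ_apply' (fun y => (escapePoly e (j PowerSeries.X) (j t)).eval y)]
      at hstep
    exact ⟨_, _, by simpa [he] using hy0, hstep⟩

theorem eval_derivative_iterate_escapePoly_critical_ne_zero [CharZero L₀] [IsAlgClosed L₀]
    (he : e ≠ 0) {c : L} (hc0 : c ≠ 0)
    (hc : (derivative (escapePoly e (j PowerSeries.X) (j t))).eval c = 0) (m : ℕ) :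
    (derivative (escapePoly e (j PowerSeries.X) (j t))).eval
      ((fun y => (escapePoly e (j PowerSeries.X) (j t)).eval y)^[m + 1] c) ≠ 0 := by
  obtain ⟨s, y, hy0, hy⟩ := exists_iterate_escapePoly_critical hj he hc0 hc m
  have hε := map_X_ne_zero_of_injective hj
  have he2 : (e : L₀) + 2 ≠ 0 := by exact_mod_cast (e + 1).succ_ne_zero
  set x := (fun y => (escapePoly e (j PowerSeries.X) (j t)).eval y)^[m + 1] c
  have hscale : (derivative (escapePoly e (j PowerSeries.X) (j t))).eval x *
      j PowerSeries.X ^ ((s + 2) * (e + 1)) =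
        j (y * (((e : PowerSeries L₀) + 2) * y ^ e + 2 * PowerSeries.X ^ ((s + 1) * e))) := by
    simp only [eval_derivative_escapePoly, map_add, map_mul, map_pow, map_natCast, map_ofNat, ← hy]
    field_simp
    ring
  intro h
  rw [h, zero_mul, eq_comm, map_eq_zero_iff j hj] at hscale
  have := congrArg PowerSeries.constantCoeff hscale
  simp [he, hy0, he2, map_ofNat PowerSeries.constantCoeff] at this

theorem exists_isTransversePeriodic_escapePoly [CharZero L₀] [IsAlgClosed L₀] (he : e ≠ 0)
    (n : ℕ) : ∃ p : L[X], p.Monic ∧ p.natDegree = e + 2 ∧ IsTransversePeriodic p n := by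
  have : CharZero L := charZero_of_injective_ringHom (j.comp PowerSeries.C).injective
  obtain ⟨t₀, ht₀, ht₀n⟩ := exists_gleason_root (L := L₀) n
  obtain ⟨t, ht, rfl⟩ := exists_powerSeries_root (gleasonDeform L₀ e (n + 1)) (a₀ := t₀)
    (by rw [map_constantCoeff_gleasonDeform he, ht₀])
    (by rw [map_constantCoeff_gleasonDeform he]; exact eval_derivative_gleason_ne_zero ht₀)
  exact ⟨escapePoly e (j PowerSeries.X) (j t), monic_escapePoly _ _ he, natDegree_escapePoly _ _ he,
    { critical := by rw [eval_derivative_escapePoly, zero_mul]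
      simple := fun c hc =>
        eval_second_derivative_escapePoly_ne_zero he (map_X_ne_zero_of_injective hj) hc
      escape := fun c hc0 hc m =>
        eval_derivative_iterate_escapePoly_critical_ne_zero hj he hc0 hc m
      not_critical := fun m hm =>
        eval_derivative_iterate_escapePoly_zero_ne_zero hj t he (ht₀n m hm)
      periodic := by rw [iterate_escapePoly_zero hj, ht, map_zero, mul_zero]
      transverse := by
        obtain ⟨D, hD, hD0⟩ := exists_orbitDeriv_escapePoly hj t he (n + 1)
        rw [hD, map_ne_zero_iff j hj]
        rintro rfl
        exact eval_derivative_gleason_ne_zero ht₀ (hD0.symm.trans (map_zero _)) }⟩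

end Escape

open scoped Classical in
theorem exists_gal_isSwap (K : Type*) [Field K] [CharZero K] {d : ℕ} (hd : 2 ≤ d) (n : ℕ) :
    ∃ g : Gal(GenericClosure K d/GenericField K d),
      (MulAction.toPerm g : Equiv.Perm (GenericVertex K d (n + 1))).IsSwap := by
  let L₀ := AlgebraicClosure K
  have : CharZero L₀ := charZero_of_injective_algebraMap (algebraMap K L₀).injective
  have : NeZero d := ⟨by omega⟩
  obtain ⟨e, rfl⟩ := Nat.exists_eq_add_of_le' hd
  rcases eq_or_ne e 0 with rfl | he
  · obtain ⟨p, hp, hpd, h⟩ := exists_isTransversePeriodic_quadratic (L := L₀) n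
    exact h.exists_gal_isSwap K hp hpd
  · let k := FractionRing (PowerSeries L₀)
    let L := AlgebraicClosure k
    have hj : Function.Injective ((algebraMap k L).comp (algebraMap (PowerSeries L₀) k)) :=
      (algebraMap k L).injective.comp (IsFractionRing.injective (PowerSeries L₀) k)
    have : CharZero L := charZero_of_injective_algebraMap (algebraMap L₀ L).injective
    obtain ⟨p, hp, hpd, h⟩ := exists_isTransversePeriodic_escapePoly hj he n
    exact h.exists_gal_isSwap K hp hpd

section TreeAut

variable {F : Type*} [Field F] {f : F[X]} {n : ℕ}

/-- The action of the tree automorphisms on the leaves, which are the roots of `f' ∘ f^n`. -/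
def leafPerm (f : F[X]) (n : ℕ) : treeAut f n →* Equiv.Perm (critPreimages f n) where
  toFun σ := σ.1 (Fin.last n)
  map_one' := rfl
  map_mul' _ _ := rfl

theorem leafPerm_arborealRep (g : Gal(AlgebraicClosure F/F)) :
    leafPerm f n (arborealRep f n g) = MulAction.toPerm g :=
  rfl

theorem leafPerm_injective
    (hf : ∀ k, Function.Surjective (parent : critPreimages f (k + 1) → critPreimages f k)) (n : ℕ) :
    Function.Injective (leafPerm f n) := by
  refine fun σ τ h => Subtype.ext (funext fun k => ?_)
  induction k using Fin.reverseInduction with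
  | last => exact h
  | cast k ih =>
    ext w
    obtain ⟨v, hv⟩ := hf k w
    have hvw := congrArg Subtype.val hv
    rw [← (σ.2 k v w).2 hvw, ← (τ.2 k v w).2 hvw, ih]

theorem mem_range_leafPerm_zero (π : Equiv.Perm (critPreimages f 0)) :
    π ∈ (leafPerm f 0).range :=
  ⟨⟨Fin.lastCases (motive := fun k : Fin 1 => Equiv.Perm (critPreimages f (k : ℕ))) π
    fun i => i.elim0, fun k => k.elim0⟩, rfl⟩

theorem exists_leafPerm_eq_of_parent_eq (σ : treeAut f n)
    {π : Equiv.Perm (critPreimages f (n + 1))}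
    (h : ∀ x, parent (π x) = leafPerm f n σ (parent x)) : π ∈ (leafPerm f (n + 1)).range := by
  let τ : (k : Fin (n + 2)) → Equiv.Perm (critPreimages f (k : ℕ)) :=
    Fin.lastCases (motive := fun k : Fin (n + 2) => Equiv.Perm (critPreimages f (k : ℕ))) π σ.1
  have hlast : τ (Fin.last n).succ = π := Fin.lastCases_last ..
  have hcast (k) : τ (Fin.castSucc k) = σ.1 k := Fin.lastCases_castSucc ..
  refine ⟨⟨τ, fun k v w => ?_⟩, hlast⟩
  cases k using Fin.lastCases with
  | last =>
    have hv : aeval (π v : AlgebraicClosure F) f = (σ.1 (Fin.last n) (parent v)).1 :=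
      congrArg Subtype.val (h v)
    rw [hlast, hcast, hv, Subtype.val_inj, Equiv.apply_eq_iff_eq, Subtype.ext_iff]
    rfl
  | cast k =>
    have hk : τ k.castSucc.succ = σ.1 k.succ := hcast k.succ
    rw [hcast, hk]
    exact σ.2 k v w

theorem mem_range_leafPerm_succ {π : Equiv.Perm (critPreimages f (n + 1))} :
    π ∈ (leafPerm f (n + 1)).range ↔
      ∃ π' ∈ (leafPerm f n).range, ∀ x, parent (π x) = π' (parent x) := by
  constructor
  · rintro ⟨σ, rfl⟩
    exact ⟨_, ⟨⟨fun k => σ.1 k.castSucc, fun k => σ.2 k.castSucc⟩, rfl⟩,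
      fun x => Subtype.ext ((σ.2 (Fin.last n) x (parent x)).2 rfl)⟩
  · rintro ⟨_, ⟨σ, rfl⟩, h⟩
    exact exists_leafPerm_eq_of_parent_eq σ h

theorem normal_critField (f : F[X]) (n : ℕ) : Normal F (critField f n) := by
  rw [IntermediateField.normal_iff_forall_map_le']
  intro σ
  rw [critField, IntermediateField.adjoin_map]
  refine IntermediateField.adjoin.mono _ _ _ ?_
  rintro _ ⟨x, hx, rfl⟩
  exact apply_mem_critPreimages f n σ hx

theorem toPerm_eq_one_iff (g : Gal(AlgebraicClosure F/F)) :
    (MulAction.toPerm g : Equiv.Perm (critPreimages f n)) = 1 ↔ ∀ x ∈ critField f n, g x = x := by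
  constructor
  · intro h x hx
    induction hx using IntermediateField.adjoin_induction with
    | mem x hx => exact congrArg Subtype.val (Equiv.ext_iff.1 h ⟨x, hx⟩)
    | algebraMap x => exact g.commutes x
    | add x y _ _ hx hy => rw [map_add, hx, hy]
    | inv x _ hx => rw [map_inv₀, hx]
    | mul x y _ _ hx hy => rw [map_mul, hx, hy]
  · exact fun h => Equiv.ext fun x =>
      Subtype.ext (h x (IntermediateField.subset_adjoin _ _ x.2))

theorem exists_mulEquiv_of_ker_eq {G G₁ G₂ : Type*} [Group G] [Group G₁] [Group G₂]
    {φ₁ : G →* G₁} {φ₂ : G →* G₂} (h₁ : Function.Surjective φ₁) (h₂ : Function.Surjective φ₂)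
    (h : φ₁.ker = φ₂.ker) : ∃ φ : G₁ ≃* G₂, ∀ g, φ (φ₁ g) = φ₂ g := by
  refine ⟨(QuotientGroup.quotientKerEquivOfSurjective φ₁ h₁).symm.trans
    ((QuotientGroup.quotientMulEquivOfEq h).trans
      (QuotientGroup.quotientKerEquivOfSurjective φ₂ h₂)), fun g => ?_⟩
  have hg : (QuotientGroup.quotientKerEquivOfSurjective φ₁ h₁).symm (φ₁ g) = (g : G ⧸ φ₁.ker) :=
    (MulEquiv.symm_apply_eq _).2 rfl
  rw [MulEquiv.trans_apply, hg]
  rfl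

theorem exists_mulEquiv_treeAut
    (hf : ∀ k, Function.Surjective (parent : critPreimages f (k + 1) → critPreimages f k))
    (hsurj : Function.Surjective (arborealRep f n)) :
    ∃ φ : Gal(critField f n/F) ≃* treeAut f n,
      ∀ (σ : Gal(critField f n/F)) (τ : Gal(AlgebraicClosure F/F)),
        (∀ x : critField f n, τ (x : AlgebraicClosure F) = (σ x : AlgebraicClosure _)) →
        φ σ = arborealRep f n τ := by
  have := normal_critField f n
  let res : Gal(AlgebraicClosure F/F) →* Gal(critField f n/F) :=
    AlgEquiv.restrictNormalHom (critField f n)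
  have hres (τ) (x : critField f n) : (res τ x : AlgebraicClosure F) = τ x :=
    AlgEquiv.restrictNormal_commutes τ (critField f n) x
  have hker : res.ker = (arborealRep f n).ker := by
    ext τ
    rw [MonoidHom.mem_ker, MonoidHom.mem_ker, ← map_eq_one_iff _ (leafPerm_injective hf n),
      leafPerm_arborealRep, toPerm_eq_one_iff, AlgEquiv.ext_iff, Subtype.forall]
    exact forall₂_congr fun x hx => by rw [← hres τ ⟨x, hx⟩, Subtype.ext_iff]; rfl
  obtain ⟨φ, hφ⟩ := exists_mulEquiv_of_ker_eq (AlgEquiv.restrictNormalHom_surjective _) hsurj hker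
  refine ⟨φ, fun σ τ h => ?_⟩
  obtain rfl : res τ = σ := by
    ext x
    rw [hres, h]
  exact hφ τ

end TreeAut

section Surjectivity

open Equiv

variable {K : Type*} [Field K] [CharZero K] {d n : ℕ}

theorem parent_surjective (hd : 2 ≤ d) (n : ℕ) :
    Function.Surjective (parent : GenericVertex K d (n + 1) → GenericVertex K d n) := by
  intro y
  have hcard : Nat.card {x : GenericVertex K d (n + 1) // parent x = y} ≠ 0 := by
    rw [card_children hd]
    omega
  exact (nonempty_subtype (p := fun x => parent x = y)).1 (Nat.card_ne_zero.1 hcard).1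

theorem exists_sibling_ne (hd : 2 ≤ d) (x : GenericVertex K d (n + 1)) :
    ∃ y, y ≠ x ∧ parent y = parent x := by
  have : NeZero d := ⟨by omega⟩
  have : Nontrivial {y : GenericVertex K d (n + 1) // parent y = parent x} :=
    Finite.one_lt_card_iff_nontrivial.1 (by rw [card_children hd]; omega)
  obtain ⟨y, hy⟩ := exists_ne (⟨x, rfl⟩ : {y : GenericVertex K d (n + 1) // parent y = parent x})
  exact ⟨y, fun h => hy (Subtype.ext h), y.2⟩

open scoped Classical in
theorem parent_eq_of_toPerm_eq_swap (hd : 2 ≤ d) {a b : GenericVertex K d (n + 1)}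
    {g : Gal(GenericClosure K d/GenericField K d)} (hg : MulAction.toPerm g = swap a b) :
    parent b = parent a := by
  have hg' (x) : g • x = swap a b x := Perm.congr_fun hg x
  -- A sibling of `a` other than `b` would be fixed, and so would be the common parent.
  obtain ⟨v, hva, hv⟩ := exists_sibling_ne hd a
  by_cases hvb : v = b
  · rw [← hvb, hv]
  · rw [← swap_apply_left a b, ← hg', parent_smul, ← hv, ← parent_smul, hg',
      swap_apply_of_ne_of_ne hva hvb]

open scoped Classical in
theorem exists_gal_toPerm_eq_swap (hd : 2 ≤ d) {x y : GenericVertex K d (n + 1)} (hxy : y ≠ x)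
    (h : parent y = parent x) :
    ∃ g : Gal(GenericClosure K d/GenericField K d), MulAction.toPerm g = swap x y := by
  obtain ⟨g, a, b, hab, hg⟩ := exists_gal_isSwap K hd n
  have := isPretransitive_genericVertex K hd (n + 1)
  obtain ⟨h₁, rfl⟩ :=
    MulAction.exists_smul_eq Gal(GenericClosure K d/GenericField K d) a x
  obtain ⟨h₂, ha, hb⟩ := exists_gal_fix_smul_sibling_eq hd
    ((MulAction.injective h₁).ne hab.symm) hxy
    (by rw [parent_smul, parent_smul, parent_eq_of_toPerm_eq_swap hd hg]) h
  refine ⟨h₂ * h₁ * g * (h₂ * h₁)⁻¹, ?_⟩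
  have hconj := swap_apply_apply (MulAction.toPerm (h₂ * h₁)) a b
  rw [MulAction.toPerm_apply, MulAction.toPerm_apply, mul_smul, mul_smul, ha, hb, ← hg] at hconj
  rw [hconj]
  exact map_mul_inv (MulAction.toPermHom _ _) _ _

theorem exists_gal_toPerm_eq_of_parent_eq (hd : 2 ≤ d) {π : Perm (GenericVertex K d (n + 1))}
    (hπ : ∀ x, parent (π x) = parent x) :
    ∃ g : Gal(GenericClosure K d/GenericField K d), MulAction.toPerm g = π := by
  classical
  have : NeZero d := ⟨by omega⟩
  let S : Set (Perm (GenericVertex K d (n + 1))) :=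
    {τ | ∃ x y, y ≠ x ∧ parent y = parent x ∧ τ = swap x y}
  have hS : Subgroup.closure S ≤ (MulAction.toPermHom Gal(GenericClosure K d/GenericField K d)
      (GenericVertex K d (n + 1))).range := by
    rw [Subgroup.closure_le]
    rintro _ ⟨x, y, hxy, h, rfl⟩
    exact exists_gal_toPerm_eq_swap hd hxy h
  refine hS ((mem_closure_isSwap ?_).2 ⟨Set.toFinite _, fun x => ?_⟩)
  · rintro _ ⟨x, y, hxy, -, rfl⟩
    exact ⟨x, y, hxy.symm, rfl⟩
  · by_cases hx : π x = x
    · rw [hx]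
      exact MulAction.mem_orbit_self x
    · exact ⟨⟨swap x (π x), Subgroup.subset_closure ⟨x, π x, hx, hπ x, rfl⟩⟩, swap_apply_left ..⟩

theorem exists_gal_toPerm_eq_of_mem_range_leafPerm (hd : 2 ≤ d) {π : Perm (GenericVertex K d n)}
    (hπ : π ∈ (leafPerm (genericMonic K d) n).range) :
    ∃ g : Gal(GenericClosure K d/GenericField K d), MulAction.toPerm g = π := by
  induction n with
  | zero =>
    have : NeZero d := ⟨by omega⟩
    exact exists_gal_toPerm_eq_critical_points π
  | succ n ih =>
    obtain ⟨π', hπ', h⟩ := mem_range_leafPerm_succ.1 hπ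
    obtain ⟨g, rfl⟩ := ih hπ'
    obtain ⟨g', hg'⟩ := exists_gal_toPerm_eq_of_parent_eq hd (π := π * MulAction.toPerm g⁻¹)
      fun x => (h _).trans (by
        rw [MulAction.toPerm_apply, MulAction.toPerm_apply, parent_smul, smul_inv_smul])
    refine ⟨g' * g, ?_⟩
    ext1 x
    rw [MulAction.toPerm_apply, mul_smul, ← MulAction.toPerm_apply g', hg', Perm.mul_apply,
      MulAction.toPerm_apply, inv_smul_smul]

theorem arborealRep_surjective (hd : 2 ≤ d) (n : ℕ) :
    Function.Surjective (arborealRep (genericMonic K d) n) := by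
  intro σ
  obtain ⟨g, hg⟩ := exists_gal_toPerm_eq_of_mem_range_leafPerm hd ⟨σ, rfl⟩
  exact ⟨g, leafPerm_injective (parent_surjective hd) n hg⟩

end Surjectivity

section RelAut

variable {W W' : Type*}

/-- The permutations of `W` that preserve each relation of a family. For a rooted tree with set of
leaves `W`, the relation `E j a b` is that `a` and `b` have the same ancestor at level `j`. -/
def relAut (E : ℕ → W → W → Prop) : Subgroup (Equiv.Perm W) where
  carrier := {π | ∀ j a b, E j (π a) (π b) ↔ E j a b}
  mul_mem' {π ρ} hπ hρ j a b := (hπ j (ρ a) (ρ b)).trans (hρ j a b)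
  one_mem' _ _ _ := Iff.rfl
  inv_mem' {π} hπ j a b := by
    rw [← hπ j, Equiv.Perm.inv_def, π.apply_symm_apply, π.apply_symm_apply]

theorem relAut_mulEquiv_of_equiv {E : ℕ → W → W → Prop} {E' : ℕ → W' → W' → Prop}
    (e : W ≃ W') (h : ∀ j a b, E' j (e a) (e b) ↔ E j a b) :
    Nonempty (relAut E ≃* relAut E') := by
  have hmap : (relAut E).map e.permCongrHom.toMonoidHom = relAut E' := by
    ext π
    rw [Subgroup.mem_map_equiv]
    refine forall_congr' fun j => e.forall_congr fun {a} => e.forall_congr fun {b} => ?_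
    rw [← h, ← h]
    simp [Equiv.permCongrHom_symm]
  exact ⟨(e.permCongrHom.subgroupMap (relAut E)).trans (MulEquiv.subgroupCongr hmap)⟩

theorem exists_perm_descent {p : W → W'} (hp : Function.Surjective p) {π : Equiv.Perm W}
    (hπ : ∀ x y, p (π x) = p (π y) ↔ p x = p y) :
    ∃ π' : Equiv.Perm W', ∀ x, p (π x) = π' (p x) := by
  obtain ⟨s, hs⟩ := hp.hasRightInverse
  have hps (x) : p (π x) = p (π (s (p x))) := (hπ _ _).2 (hs _).symm
  refine ⟨Equiv.ofBijective (fun w => p (π (s w))) ⟨fun v w hvw => ?_, fun w => ?_⟩, hps⟩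
  · simpa only [hs v, hs w] using (hπ _ _).1 hvw
  · exact ⟨p (π.symm (s w)), by beta_reduce; rw [← hps, π.apply_symm_apply, hs w]⟩

/-- A vertex of the tree with leaves `W'` is identified with the vertex of the tree with leaves `W`
below it, so that the two trees agree up to level `N`, the level of the leaves `W'`. -/
theorem mem_relAut_iff_exists_descent {p : W → W'} (hp : Function.Surjective p)
    {E : ℕ → W → W → Prop} {E' : ℕ → W' → W' → Prop} {N : ℕ}
    (hle : ∀ j ≤ N, ∀ x y, E j x y ↔ E' j (p x) (p y)) (hgt : ∀ j > N, ∀ x y, E j x y ↔ x = y)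
    (hN : ∀ j ≥ N, ∀ x y, E' j x y ↔ x = y) {π : Equiv.Perm W} :
    π ∈ relAut E ↔ ∃ π' ∈ relAut E', ∀ x, p (π x) = π' (p x) := by
  constructor
  · intro hπ
    obtain ⟨π', hπ'⟩ := exists_perm_descent hp fun x y => by
      simpa only [hle N le_rfl, hN N le_rfl] using hπ N x y
    refine ⟨π', fun j => hp.forall₂.2 fun x y => ?_, hπ'⟩
    rcases le_total j N with hj | hj
    · rw [← hπ', ← hπ', ← hle j hj, ← hle j hj]
      exact hπ j x y
    · rw [hN j hj, hN j hj, π'.apply_eq_iff_eq]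
  · rintro ⟨π', hπ', h⟩ j x y
    rcases le_or_gt j N with hj | hj
    · rw [hle j hj, hle j hj, h, h]
      exact hπ' j _ _
    · rw [hgt j hj, hgt j hj, π.apply_eq_iff_eq]

end RelAut

section WreathAction

/-- The relations of the tree obtained by joining a new root to the roots of `m` copies of the tree
with relations `E`. -/
def consRel (m : ℕ) {W : Type*} (E : ℕ → W → W → Prop) : ℕ → Fin m × W → Fin m × W → Prop
  | 0, _, _ => True
  | j + 1, a, b => a.1 = b.1 ∧ E j a.2 b.2

variable {m : ℕ} {W : Type} {E : ℕ → W → W → Prop}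

/-- The imprimitive action of the wreath product of `relAut E` on `m` copies of `W`. -/
def wreathAction (m : ℕ) (E : ℕ → W → W → Prop) :
    SymWreath m (relAut E) →* Equiv.Perm (Fin m × W) where
  toFun g :=
    { toFun := fun a => (g.right a.1, (g.left (g.right a.1)).1 a.2)
      invFun := fun a => (g.right.symm a.1, (g.left a.1).1.symm a.2)
      left_inv := fun a => by simp
      right_inv := fun a => by simp }
  map_one' := by
    ext a <;> simp
  map_mul' g h := by
    ext1 a
    refine Prod.ext rfl ?_
    change (g.left _ * h.left (g.right.symm (g.right (h.right a.1)))).1 a.2 = _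
    rw [g.right.symm_apply_apply]
    rfl

theorem wreathAction_apply (g : SymWreath m (relAut E)) (a : Fin m × W) :
    wreathAction m E g a = (g.right a.1, (g.left (g.right a.1)).1 a.2) :=
  rfl

theorem wreathAction_injective [Nonempty W] : Function.Injective (wreathAction m E) := by
  intro g h hgh
  have happ (i v) : (g.right i, (g.left (g.right i)).1 v) = (h.right i, (h.left (h.right i)).1 v) :=
    Equiv.Perm.congr_fun hgh (i, v)
  have hright : g.right = h.right :=
    Equiv.ext fun i => congrArg Prod.fst (happ i (Classical.arbitrary W))
  refine SemidirectProduct.ext (funext fun i => ?_) hright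
  ext v
  obtain ⟨i, rfl⟩ := g.right.surjective i
  simpa only [hright] using congrArg Prod.snd (happ i v)

theorem wreathAction_mem_relAut (g : SymWreath m (relAut E)) :
    wreathAction m E g ∈ relAut (consRel m E) := by
  rintro (_ | j) a b
  · exact Iff.rfl
  · simp only [consRel, wreathAction_apply, Equiv.apply_eq_iff_eq]
    refine and_congr_right fun h => ?_
    rw [h]
    exact (g.left _).2 j _ _

theorem bijective_snd_of_fst_eq {π : Equiv.Perm (Fin m × W)} {σ : Equiv.Perm (Fin m)}
    (hσ : ∀ a, (π a).1 = σ a.1) (i : Fin m) :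
    Function.Bijective fun v => (π (i, v)).2 := by
  refine ⟨fun v w hvw => ?_, fun w => ?_⟩
  · have h : π (i, v) = π (i, w) := Prod.ext (by rw [hσ, hσ]) hvw
    exact congrArg Prod.snd (π.injective h)
  · obtain ⟨⟨j, v⟩, hjv⟩ := π.surjective (σ i, w)
    obtain rfl : j = i := σ.injective (by rw [← hσ (j, v), hjv])
    exact ⟨v, congrArg Prod.snd hjv⟩

theorem mem_range_wreathAction [Nonempty W] (hE : ∀ a b, E 0 a b) {π : Equiv.Perm (Fin m × W)}
    (hπ : π ∈ relAut (consRel m E)) : π ∈ (wreathAction m E).range := by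
  obtain ⟨σ, hσ⟩ := exists_perm_descent (p := (Prod.fst : Fin m × W → Fin m))
    Prod.fst_surjective fun a b => by simpa only [consRel, hE, and_true] using hπ 1 a b
  let τ (i : Fin m) : Equiv.Perm W := Equiv.ofBijective _ (bijective_snd_of_fst_eq hσ (σ.symm i))
  have hτ (i) : τ i ∈ relAut E := fun j a b => by
    have h := hπ (j + 1) (σ.symm i, a) (σ.symm i, b)
    simp only [consRel, hσ, true_and] at h
    exact h
  refine ⟨⟨fun i => ⟨τ i, hτ i⟩, σ⟩, ?_⟩
  ext1 a
  refine Prod.ext (hσ a).symm ?_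
  change (π (σ.symm (σ a.1), a.2)).2 = (π a).2
  rw [σ.symm_apply_apply]

theorem symWreath_mulEquiv_relAut [Nonempty W] (hE : ∀ a b, E 0 a b) :
    Nonempty (SymWreath m (relAut E) ≃* relAut (consRel m E)) := by
  have hrange : (wreathAction m E).range = relAut (consRel m E) :=
    le_antisymm (by rintro _ ⟨g, rfl⟩; exact wreathAction_mem_relAut g)
      fun _ => mem_range_wreathAction hE
  exact ⟨(MonoidHom.ofInjective wreathAction_injective).trans (MulEquiv.subgroupCongr hrange)⟩

theorem symWreath_congr (m : ℕ) {H H' : Type} [Group H] [Group H'] (e : H ≃* H') :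
    Nonempty (SymWreath m H ≃* SymWreath m H') :=
  ⟨SemidirectProduct.congr (MulEquiv.piCongrRight fun _ => e) (MulEquiv.refl _) fun _ => rfl⟩

end WreathAction

section WordRel

variable {m d n j : ℕ}

/-- Agreement of the first `j` letters of two words: the relations of the complete `d`-ary tree of
height `n`. -/
def wordRel (d n j : ℕ) (w w' : Fin n → Fin d) : Prop :=
  ∀ i : Fin n, (i : ℕ) < j → w i = w' i

theorem wordRel_zero (w w' : Fin n → Fin d) : wordRel d n 0 w w' :=
  fun i hi => absurd hi (Nat.not_lt_zero i)

theorem wordRel_consEquiv (a b : Fin d × (Fin n → Fin d)) :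
    wordRel d (n + 1) j (Fin.consEquiv (fun _ => Fin d) a) (Fin.consEquiv (fun _ => Fin d) b) ↔
      consRel d (wordRel d n) j a b := by
  cases j with
  | zero => exact iff_of_true (wordRel_zero _ _) trivial
  | succ j => simp [wordRel, consRel, Fin.forall_fin_succ, Fin.consEquiv]

theorem iterSymWreath_mulEquiv_relAut [NeZero d] (n : ℕ) :
    Nonempty (IterSymWreath d n ≃* relAut (wordRel d n)) := by
  induction n with
  | zero =>
    have : Unique (IterSymWreath d 0) := inferInstanceAs (Unique PUnit)
    have : Unique (relAut (wordRel d 0)) :=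
      { default := 1, uniq := fun π => Subtype.ext (Equiv.ext fun w => Subsingleton.elim _ _) }
    exact ⟨MulEquiv.ofUnique⟩
  | succ n ih =>
    obtain ⟨e₁⟩ := ih
    obtain ⟨e₂⟩ := symWreath_congr d e₁
    obtain ⟨e₃⟩ := symWreath_mulEquiv_relAut (m := d) (wordRel_zero (n := n) (d := d))
    obtain ⟨e₄⟩ := relAut_mulEquiv_of_equiv (E' := wordRel d (n + 1))
      (Fin.consEquiv fun _ => Fin d) fun _ => wordRel_consEquiv
    exact ⟨(e₂.trans e₃).trans e₄⟩

theorem consRel_wordRel_iff_eq (hj : n < j) (a b : Fin m × (Fin n → Fin d)) :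
    consRel m (wordRel d n) j a b ↔ a = b := by
  obtain ⟨j, rfl⟩ := Nat.exists_eq_succ_of_ne_zero (Nat.ne_zero_of_lt hj)
  rw [consRel, Prod.ext_iff, wordRel]
  refine and_congr_right fun _ => ⟨fun h => funext fun i => h i (by omega), fun h i _ => by rw [h]⟩

theorem consRel_wordRel_snoc (hj : j ≤ n + 1) (a b : Fin m × (Fin n → Fin d)) (u v : Fin d) :
    consRel m (wordRel d (n + 1)) j (a.1, Fin.snoc (α := fun _ => Fin d) a.2 u)
      (b.1, Fin.snoc (α := fun _ => Fin d) b.2 v) ↔ consRel m (wordRel d n) j a b := by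
  cases j with
  | zero => exact Iff.rfl
  | succ j =>
    have hjn : ¬n < j := by omega
    simp [consRel, wordRel, Fin.forall_fin_succ', hjn]

end WordRel

section Labels

variable {K : Type*} [Field K] [CharZero K] {d : ℕ}

theorem exists_children_labels (hd : 2 ≤ d) (n : ℕ) :
    ∃ e : GenericVertex K d (n + 1) ≃ GenericVertex K d n × Fin d, ∀ x, (e x).1 = parent x := by
  have : NeZero d := ⟨by omega⟩
  have hfiber (y : GenericVertex K d n) :
      Nonempty ({x : GenericVertex K d (n + 1) // parent x = y} ≃ Fin d) :=
    Finite.card_eq.1 ((card_children hd y).trans (Nat.card_fin d).symm)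
  exact ⟨((Equiv.sigmaFiberEquiv parent).symm.trans
    (Equiv.sigmaCongrRight fun y => (hfiber y).some)).trans (Equiv.sigmaEquivProd _ _),
    fun _ => rfl⟩

theorem exists_label_zero (hd : 2 ≤ d) :
    ∃ l : GenericVertex K d 0 ≃ Fin (d - 1) × (Fin 0 → Fin d),
      (leafPerm (genericMonic K d) 0).range =
        relAut (fun j x y => consRel (d - 1) (wordRel d 0) j (l x) (l y)) := by
  have : NeZero d := ⟨by omega⟩
  obtain ⟨l⟩ : Nonempty (GenericVertex K d 0 ≃ Fin (d - 1) × (Fin 0 → Fin d)) :=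
    Finite.card_eq.1 (by rw [card_genericVertex K hd]; simp)
  refine ⟨l, Subgroup.ext fun π => iff_of_true (mem_range_leafPerm_zero π) ?_⟩
  rintro (_ | j) x y
  · exact Iff.rfl
  · simp only [consRel_wordRel_iff_eq j.succ_pos, Equiv.apply_eq_iff_eq]

theorem exists_label_succ (hd : 2 ≤ d) {n : ℕ}
    {l : GenericVertex K d n ≃ Fin (d - 1) × (Fin n → Fin d)}
    (hl : (leafPerm (genericMonic K d) n).range =
      relAut (fun j x y => consRel (d - 1) (wordRel d n) j (l x) (l y))) :
    ∃ l' : GenericVertex K d (n + 1) ≃ Fin (d - 1) × (Fin (n + 1) → Fin d),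
      (leafPerm (genericMonic K d) (n + 1)).range =
        relAut (fun j x y => consRel (d - 1) (wordRel d (n + 1)) j (l' x) (l' y)) := by
  obtain ⟨e, he⟩ := exists_children_labels (K := K) hd n
  let l' : GenericVertex K d (n + 1) ≃ Fin (d - 1) × (Fin (n + 1) → Fin d) :=
    { toFun := fun x => ((l (e x).1).1, Fin.snoc (α := fun _ => Fin d) (l (e x).1).2 (e x).2)
      invFun := fun a => e.symm (l.symm (a.1, Fin.init a.2), a.2 (Fin.last n))
      left_inv := fun x => by simp
      right_inv := fun a => by simp }
  refine ⟨l', Subgroup.ext fun π => ?_⟩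
  rw [mem_range_leafPerm_succ, hl]
  refine (mem_relAut_iff_exists_descent (N := n + 1) (parent_surjective hd n)
    (fun j hj x y => ?_) (fun j hj x y => ?_) fun j hj x y => ?_).symm
  · rw [← he, ← he]
    exact consRel_wordRel_snoc hj _ _ _ _
  · rw [consRel_wordRel_iff_eq hj, l'.apply_eq_iff_eq]
  · rw [consRel_wordRel_iff_eq hj, l.apply_eq_iff_eq]

theorem exists_label (hd : 2 ≤ d) (n : ℕ) :
    ∃ l : GenericVertex K d n ≃ Fin (d - 1) × (Fin n → Fin d),
      (leafPerm (genericMonic K d) n).range =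
        relAut (fun j x y => consRel (d - 1) (wordRel d n) j (l x) (l y)) := by
  induction n with
  | zero => exact exists_label_zero hd
  | succ n ih =>
    obtain ⟨l, hl⟩ := ih
    exact exists_label_succ hd hl

variable (K) in
theorem treeAut_mulEquiv_symWreath (hd : 2 ≤ d) (n : ℕ) :
    Nonempty (treeAut (genericMonic K d) n ≃* SymWreath (d - 1) (IterSymWreath d n)) := by
  have : NeZero d := ⟨by omega⟩
  obtain ⟨l, hl⟩ := exists_label (K := K) hd n
  obtain ⟨e₁⟩ := relAut_mulEquiv_of_equiv (E' := consRel (d - 1) (wordRel d n)) l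
    fun _ _ _ => Iff.rfl
  obtain ⟨e₂⟩ := symWreath_mulEquiv_relAut (m := d - 1) (wordRel_zero (n := n) (d := d))
  obtain ⟨e₃⟩ := iterSymWreath_mulEquiv_relAut (d := d) n
  obtain ⟨e₄⟩ := symWreath_congr (d - 1) e₃
  exact ⟨((((MonoidHom.ofInjective (leafPerm_injective (parent_surjective hd) n)).trans
    (MulEquiv.subgroupCongr hl)).trans e₁).trans e₂.symm).trans e₄.symm⟩

end Labels

theorem theorem1p1_general (K : Type*) [Field K] [CharZero K] (d : ℕ) (hd : 2 ≤ d) (n : ℕ) :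
    Function.Surjective (arborealRep (genericMonic K d) n) ∧
    (∃ φ : Gal(critField (genericMonic K d) n / GenericField K d) ≃* treeAut (genericMonic K d) n,
      ∀ (σ : Gal(critField (genericMonic K d) n / GenericField K d))
        (τ : Gal(AlgebraicClosure (GenericField K d) / GenericField K d)),
        (∀ x : critField (genericMonic K d) n,
          τ (x : AlgebraicClosure (GenericField K d)) = (σ x : AlgebraicClosure _)) →
        φ σ = arborealRep (genericMonic K d) n τ) ∧
    Nonempty (Gal(critField (genericMonic K d) n / GenericField K d) ≃*
      SymWreath (d - 1) (IterSymWreath d n)) := by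
  have hsurj := arborealRep_surjective (K := K) hd n
  obtain ⟨φ, hφ⟩ := exists_mulEquiv_treeAut (parent_surjective hd) hsurj
  obtain ⟨e⟩ := treeAut_mulEquiv_symWreath K hd n
  exact ⟨hsurj, ⟨φ, hφ⟩, ⟨φ.trans e⟩⟩

end

/-- For the generic monic polynomial `f` of degree `d ≥ 2` over a number field `K`: the arboreal
representation on the tree of backward orbits of the critical points is surjective; it induces an
isomorphism of `Gal(K_{s,t}((f' ∘ f^n)⁻¹(0)) / K_{s,t})` with the automorphism group of the tree;
and this Galois group is isomorphic to `S_{d-1}[[S_d]^n]`. -/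
theorem theorem1p1 (K : Type*) [Field K] [NumberField K] (d : ℕ) (hd : 2 ≤ d) (n : ℕ) :
    Function.Surjective (arborealRep (genericMonic K d) n) ∧
    (∃ φ : Gal(critField (genericMonic K d) n / GenericField K d) ≃* treeAut (genericMonic K d) n,
      ∀ (σ : Gal(critField (genericMonic K d) n / GenericField K d))
        (τ : Gal(AlgebraicClosure (GenericField K d) / GenericField K d)),
        (∀ x : critField (genericMonic K d) n,
          τ (x : AlgebraicClosure (GenericField K d)) = (σ x : AlgebraicClosure _)) →
        φ σ = arborealRep (genericMonic K d) n τ) ∧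
    Nonempty (Gal(critField (genericMonic K d) n / GenericField K d) ≃*
      SymWreath (d - 1) (IterSymWreath d n)) :=
  theorem1p1_general K d hd n
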